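/- Let $\alpha>0$ and $k\ge 2$. A plane tree is a tree with a cyclic order of the neighbours of every vertex; a corner is an angular sector between two consecutive edges at a vertex; the corners are coloured by declaring exactly one corner at each vertex red and all others blue. A planted plane tree is a plane tree with a root vertex that carries an additional half-edge (so that a planted tree with one vertex has one corner); its corners are coloured in the same way, except that the root has either one red corner or none. Let $S$ be a plane tree with $k$ vertices and coloured corners. The planar $\alpha$-PA with seed $S$ is the Markov process $(T_n)_{n\ge k}$ of plane trees with coloured corners such that $T_k=S$ and $T_{n+1}$ is obtained from $T_n$ as follows: independently of the past, choose a corner of $T_n$ with probability proportional to $\alpha$ if it is red and to $1$ if it is blue (that is, with probability $\frac{\alpha}{n(1+\alpha)-2}$, respectively $\frac{1}{n(1+\alpha)-2}$), and join a new vertex to the vertex $u$ of that corner by an edge drawn through the corner. The only corner of the new vertex is red; of the two parts of the chosen corner, the one to the right of the new edge (oriented away from $u$) inherits the colour of the chosen corner and the other one is blue; all other corners keep their colours. The same rule, started from the planted tree with one vertex whose only corner is red (respectively blue), defines the red (respectively blue) planted planar $\alpha$-PA tree $T_m^{\multimap r}$ (respectively $T_m^{\multimap b}$) with $m\ge1$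 vertices. For a corner $c$ of $S$ at a vertex $v$, the planted plane subtree $T_n^{c}$ consists of $v$ and of all vertices of $T_n$ outside $S$ whose path to $S$ arrives at $S$ through $c$; it is rooted at $v$, with a half-edge at $v$ that stands for everything outside of $c$. Let $k_n^c$ be its number of vertices, and put $x_n^c=(1+\alpha)k_n^c-1$ if $c$ is red and $x_n^c=(1+\alpha)k_n^c-\alpha$ if $c$ is blue. Then: 1. $S$ has $2k-2$ corners, and the process $\big((x_n^c)_c\big)_{n\ge k}$ is a Pólya urn with $2k-2$ colours and diagonal replacement matrix $(1+\alpha)I_{2k-2}$, with initial value (at time $k$) $\alpha$ for each red corner $c$ and $1$ for each blue corner $c$. That is, given the past, colour $c$ is drawn at time $n$ with probability $x_n^c/\sum_{c'}x_n^{c'}$, and then $1+\alpha$ is added to its entry. 2. For every $n\ge k$, conditionally on the sizes $(k_n^c)_c$, the trees $(T_n^c)_c$ (planted plane trees with coloured corners, with vertices unlabelled) are independent, and $T_n^c$ has the law of $T^{\multimap r}_{k_n^c}$ if $c$ is red and of $T^{\multimap b}_{k_n^c}$ if $c$ is blue. 3. Let $S'$ be another plane tree with $k$ vertices and coloured corners.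 There are colour-preserving bijections from the corners of $S$ to those of $S'$, and for each such bijection $\varphi$ the planar $\alpha$-PA processes with seeds $S$ and $S'$ can be defined on a common probability space in such a way that, almost surely, for all $n\ge k$ and all corners $c$ of $S$, the planted plane subtree of $T_n^S$ stemming from $c$ and the one of $T_n^{S'}$ stemming from $\varphi(c)$ are equal as unlabelled planted plane trees with coloured corners. -/

import Mathlib

open MeasureTheory ProbabilityTheory
open scoped ENNReal

namespace PlanarPA

/-- The colour of a corner. -/
inductive Colour : Type
  | red
  | blue
  deriving DecidableEq

/-- The weight of a corner in the attachment mechanism: `α` if it is red, `1` if it is blue. -/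
def Colour.weight (α : ℝ) : Colour → ℝ
  | .red => α
  | .blue => 1

/-- Data of a (possibly planted) plane tree with coloured corners whose vertices are labelled by
natural numbers. For a vertex `u`, the list `rot u` describes the surroundings of `u`: its entries
are the half-edges at `u` in clockwise cyclic order (the starting point of the list is
irrelevant). An entry `(some w, χ)` is the edge from `u` to `w`, an entry `(none, χ)` is a
half-edge without other endpoint, as in a planted tree; `χ` is the colour of the corner at `u`
that comes just after the entry in clockwise order, that is, of the corner to the right of the
half-edge oriented away from `u`. -/
structure Tree : Type where
  verts : Finset ℕ
  rot : ℕ → List (Option ℕ × Colour)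

/-- A corner, given by its vertex, the half-edge that precedes it clockwise, and its colour. -/
structure Corner : Type where
  vertex : ℕ
  after : Option ℕ
  colour : Colour
  deriving DecidableEq

namespace Tree

/-- The half-edges at `u` in clockwise order. -/
def ends (T : Tree) (u : ℕ) : List (Option ℕ) := (T.rot u).map Prod.fst

/-- The underlying graph. -/
def graph (T : Tree) : SimpleGraph ℕ :=
  SimpleGraph.fromRel fun u w => some w ∈ T.ends u

/-- The corners of a tree. -/
def corners (T : Tree) : Finset Corner :=
  T.verts.biUnion fun u => ((T.rot u).map fun e => (⟨u, e.1, e.2⟩ : Corner)).toFinset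

/-- `T` is a (not planted) plane tree with coloured corners: its graph is a tree, `rot u` lists
every neighbour of `u` exactly once and contains nothing else, and exactly one corner at each
vertex is red. -/
structure IsColouredPlaneTree (T : Tree) : Prop where
  isTree : (T.graph.induce (T.verts : Set ℕ)).IsTree
  nodup : ∀ u ∈ T.verts, (T.ends u).Nodup
  ends_eq : ∀ u ∈ T.verts, ∀ x, x ∈ T.ends u ↔ ∃ w ∈ T.verts, T.graph.Adj u w ∧ x = some w
  one_red : ∀ u ∈ T.verts, (T.rot u).countP (fun e => e.2 = Colour.red) = 1
  outside : ∀ u, u ∉ T.verts → T.rot u = []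

/-- A seed of size `k`: a plane tree with coloured corners, with vertices labelled `1, …, k`. -/
structure IsSeed (k : ℕ) (S : Tree) : Prop where
  tree : S.IsColouredPlaneTree
  verts_eq : S.verts = Finset.Icc 1 k

/-- Add a new vertex `w`, joined by an edge to the vertex of the corner `c` through `c`. The corner
is split in two: the part to the right of the edge (from the old vertex to `w`) inherits the colour
of `c` and the other part is blue. The unique corner of `w` is red. -/
def attach (T : Tree) (c : Corner) (w : ℕ) : Tree where
  verts := insert w T.verts
  rot x :=
    if x = w then [(some c.vertex, Colour.red)]
    else if x = c.vertex then
      (T.rot x).flatMap fun e =>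
        if e.1 = c.after then [(e.1, Colour.blue), (some w, e.2)] else [e]
    else T.rot x

/-- The weight of `c` as a corner of `T`. -/
noncomputable def cornerWeight (α : ℝ) (T : Tree) (c : Corner) : ℝ≥0∞ :=
  if c ∈ T.corners then ENNReal.ofReal (c.colour.weight α) else 0

theorem tsum_cornerWeight_ne_top (α : ℝ) (T : Tree) : ∑' c, T.cornerWeight α c ≠ ⊤ := by
  rw [tsum_eq_sum (s := T.corners) (fun c hc => by simp [cornerWeight, hc])]
  refine ENNReal.sum_ne_top.2 fun c hc => ?_
  simp [cornerWeight, hc]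

open Classical in
/-- One step of preferential attachment: choose a corner with probability proportional to its
weight (`α` if red, `1` if blue) and attach the next vertex there. For a plane tree with `n ≥ 2`
vertices and `α > 0` the total weight is `n (1 + α) - 2`. (If the total weight is `0` there is
nothing to choose from, and the tree stays; this does not occur below.) -/
noncomputable def step (α : ℝ) (T : Tree) : PMF Tree :=
  if h : ∑' c, T.cornerWeight α c ≠ 0 then
    (PMF.normalize (T.cornerWeight α) h (T.tsum_cornerWeight_ne_top α)).map
      fun c => T.attach c (T.verts.card + 1)
  else PMF.pure T

/-- The law of the tree obtained from `T` by `m` steps of preferential attachment. -/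
noncomputable def growth (α : ℝ) (T : Tree) : ℕ → PMF Tree
  | 0 => PMF.pure T
  | m + 1 => (growth α T m).bind (step α)

/-- Equality of (possibly planted) plane trees with coloured corners up to relabelling of the
vertices (orientation-preserving homeomorphism of the plane). -/
def Iso (T T' : Tree) : Prop :=
  ∃ f : Equiv.Perm ℕ, T'.verts = T.verts.map f.toEmbedding ∧
    ∀ u ∈ T.verts, (T.rot u).map (Prod.map (Option.map f) id) ~r T'.rot (f u)

theorem Iso.refl (T : Tree) : T.Iso T :=
  ⟨Equiv.refl ℕ, by ext; simp, fun u _ => by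
    have h : (Prod.map (Option.map (Equiv.refl ℕ)) id : Option ℕ × Colour → _) = id := by
      ext x <;> simp
    rw [h, List.map_id]; exact List.IsRotated.refl _⟩

theorem Iso.symm {T T' : Tree} (h : T.Iso T') : T'.Iso T := by
  obtain ⟨f, hv, hr⟩ := h
  refine ⟨f.symm, by ext x; simp [hv], fun u hu => ?_⟩
  have hu' : f.symm u ∈ T.verts := by
    rw [hv] at hu
    obtain ⟨x, hx, rfl⟩ := Finset.mem_map.1 hu
    simpa using hx
  have h1 := ((hr _ hu').map (Prod.map (Option.map f.symm) id)).symm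
  have h2 : (Prod.map (Option.map f.symm) id ∘ Prod.map (Option.map f) id :
      Option ℕ × Colour → _) = id := by
    ext x <;> simp
  rw [List.map_map, h2, List.map_id, Equiv.apply_symm_apply] at h1
  exact h1

theorem Iso.trans {T T' T'' : Tree} (h : T.Iso T') (h' : T'.Iso T'') : T.Iso T'' := by
  obtain ⟨f, hv, hr⟩ := h
  obtain ⟨g, hv', hr'⟩ := h'
  refine ⟨f.trans g, by rw [hv', hv, Finset.map_map]; rfl, fun u hu => ?_⟩
  have hu' : f u ∈ T'.verts := by rw [hv]; simpa using hu
  have h1 := ((hr u hu).map (Prod.map (Option.map g) id)).trans (hr' _ hu')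
  simpa [List.map_map, Function.comp_def, Prod.map_map] using h1

instance isoSetoid : Setoid Tree where
  r := Iso
  iseqv := ⟨Iso.refl, Iso.symm, Iso.trans⟩

end Tree

/-- (Possibly planted) plane trees with coloured corners, up to relabelling of the vertices. -/
abbrev Shape : Type := Quotient Tree.isoSetoid

/-- The unlabelled tree underlying a labelled tree. -/
def Tree.shape (T : Tree) : Shape := Quotient.mk Tree.isoSetoid T

/-- The planted plane tree with one vertex, a half-edge, and one corner of colour `χ`. -/
def bud (χ : Colour) : Tree where
  verts := {1}
  rot u := if u = 1 then [(none, χ)] else []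

/-- The law of the planted planar preferential attachment tree with `m ≥ 1` vertices, grown from
the red, respectively blue, planted tree with one vertex. -/
noncomputable def plantedLaw (α : ℝ) (χ : Colour) (m : ℕ) : PMF Shape :=
  (Tree.growth α (bud χ) (m - 1)).map Tree.shape

section Subtrees

/-- What lies in `T` inside the corner `c` of the seed `S`: turn clockwise around the vertex of
`c`, from the half-edge of `S` where `c` begins to the next half-edge of `S`. The half-edge of `S`
at the beginning is replaced by a half-edge without endpoint, which stands for everything that is
outside of `c`. -/
def sector (S T : Tree) (c : Corner) : List (Option ℕ × Colour) :=
  match (T.rot c.vertex ++ T.rot c.vertex).dropWhile (fun e => e.1 ≠ c.after) with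
  | [] => []
  | e :: l => (none, e.2) :: l.takeWhile (fun e => e.1 ∉ S.verts.image some)

/-- `u` is a descendant in `T` of the corner `c` of the seed `S`: it is the vertex of `c`, or it is
not in `S` and the path in `T` from `u` to `S` arrives at `S` through `c`. -/
def IsDescendant (S T : Tree) (c : Corner) (u : ℕ) : Prop :=
  u = c.vertex ∨
    (u ∈ T.verts \ S.verts ∧
      ∃ p : T.graph.Walk u c.vertex, p.IsPath ∧
        (∀ x ∈ p.support, x ∈ S.verts → x = c.vertex) ∧
        some p.penultimate ∈ (sector S T c).map Prod.fst)

open Classical in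
/-- The planted plane subtree of `T` stemming from the corner `c` of the seed `S`. -/
noncomputable def subtree (S T : Tree) (c : Corner) : Tree where
  verts := T.verts.filter (IsDescendant S T c)
  rot u :=
    if u = c.vertex then sector S T c
    else if u ∈ T.verts ∧ IsDescendant S T c u then T.rot u
    else []

/-- The size of the planted plane subtree stemming from the corner `c`. -/
noncomputable def subtreeSize (S T : Tree) (c : Corner) : ℕ := (subtree S T c).verts.card

end Subtrees

section Processes

variable {Ω : Type*} [MeasurableSpace Ω]

/-- `(T n)`, `n ≥ k`, is a planar `α`-preferential attachment process with seed `S` under `μ`. -/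
structure IsPlanarPA (α : ℝ) (k : ℕ) (S : Tree) (μ : Measure Ω) (T : ℕ → Ω → Tree) : Prop where
  measurable : ∀ n ≥ k, ∀ A : Set Tree, MeasurableSet (T n ⁻¹' A)
  start : ∀ᵐ ω ∂μ, T k ω = S
  transition : ∀ n ≥ k, ∀ (t : ℕ → Tree) (y : Tree),
    μ {ω | (∀ j ∈ Finset.Icc k n, T j ω = t j) ∧ T (n + 1) ω = y} =
      μ {ω | ∀ j ∈ Finset.Icc k n, T j ω = t j} * (t n).step α y

open Classical in
/-- `(X n)`, `n ≥ k`, is a Pólya urn under `μ` with colours `ι`, replacement matrix `M` and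
composition `x₀` at time `k`: given the past, colour `i` is drawn with probability
`X n i / ∑ j, X n j`, and row `i` of `M` is added to the composition. -/
structure IsPolyaUrn {ι : Type*} [Fintype ι] (M : Matrix ι ι ℝ) (x₀ : ι → ℝ) (k : ℕ)
    (μ : Measure Ω) (X : ℕ → Ω → ι → ℝ) : Prop where
  measurable : ∀ n ≥ k, Measurable (X n)
  start : ∀ᵐ ω ∂μ, X k ω = x₀
  transition : ∀ n ≥ k, ∀ (x : ℕ → ι → ℝ) (y : ι → ℝ),
    μ {ω | (∀ j ∈ Finset.Icc k n, X j ω = x j) ∧ X (n + 1) ω = y} =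
      μ {ω | ∀ j ∈ Finset.Icc k n, X j ω = x j} *
        ∑ i with y = x n + M i, ENNReal.ofReal (x n i / ∑ j, x n j)

/-- The rescaled size of a planted subtree with `m` vertices. -/
def rescaled (α : ℝ) : Colour → ℕ → ℝ
  | .red, m => (1 + α) * m - 1
  | .blue, m => (1 + α) * m - α

end Processes

end PlanarPA

/-! The heart is a deterministic decomposition. A tree grown from `S` is `S` with a planted tree
glued into each corner (`Glued`). Its corners are the disjoint union of the corners of the planted
trees, with the same colours (`Glued.sum_corners`), and attaching a vertex at one of them is the
same operation inside a single planted tree (`Glued.attach`). The geometric definition of `subtree`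
recovers the planted trees exactly (`Glued.subtree_eq`).

A planted tree with `m` vertices has `2m - 1` corners, `m` or `m - 1` of them red according to the
colour it started from, so its total weight is `rescaled`. A step therefore selects the corner `c`
of the seed with probability proportional to its rescaled size, which is the urn
(`IsGrown.urn_step`), and then performs one step of planted preferential attachment in the tree at
`c`. The selection depends on the sizes only. Hence, by induction on the number of steps, the
expectation of a product of functions of the subtrees, restricted to prescribed sizes, factorizes
(`expect_growth_sizedProd`). The functions must be invariant under relabelling, since a subtree does
not carry the labels of a free-standing planted tree.

For the coupling, isomorphic subtrees at matched corners give a weight-preserving bijection between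
the corners of the two trees: draw a corner in one tree and use its image in the other
(`Coupled.exists_step`). The chain of pairs comes from the Ionescu-Tulcea theorem
(`exists_markovChain`).

The process is given only through probabilities of single histories, and there are uncountably many
trees. Histories almost surely lie in a countable set, which allows the passage to events
(`IsPlanarPA.transition_event`, `IsPlanarPA.law`). -/

namespace PlanarPA

/-! ### Attachment, and planted trees -/

namespace Tree

theorem mem_ends {T : Tree} {u : ℕ} {x : Option ℕ} : x ∈ T.ends u ↔ ∃ χ, (x, χ) ∈ T.rot u := by
  simp [ends]

theorem mem_corners {T : Tree} {d : Corner} :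
    d ∈ T.corners ↔ d.vertex ∈ T.verts ∧ (d.after, d.colour) ∈ T.rot d.vertex := by
  obtain ⟨v, a, χ⟩ := d
  simp only [corners, Finset.mem_biUnion, List.mem_toFinset, List.mem_map, Corner.mk.injEq]
  constructor
  · rintro ⟨u, hu, ⟨x, y⟩, he, rfl, rfl, rfl⟩
    exact ⟨hu, he⟩
  · rintro ⟨hu, he⟩
    exact ⟨v, hu, (a, χ), he, rfl, rfl, rfl⟩

/-- The effect of `attach` on the surroundings of the vertex of the corner. -/
def splitEntry (a : Option ℕ) (w : ℕ) (e : Option ℕ × Colour) : List (Option ℕ × Colour) :=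
  if e.1 = a then [(e.1, Colour.blue), (some w, e.2)] else [e]

theorem attach_rot_new (T : Tree) (d : Corner) (w : ℕ) :
    (T.attach d w).rot w = [(some d.vertex, Colour.red)] := by
  simp [attach]

theorem attach_rot_vertex (T : Tree) (d : Corner) {w : ℕ} (h : d.vertex ≠ w) :
    (T.attach d w).rot d.vertex = (T.rot d.vertex).flatMap (splitEntry d.after w) := by
  simp only [attach, if_neg h, if_true]; rfl

theorem attach_rot_other (T : Tree) (d : Corner) {w u : ℕ} (h : u ≠ w) (h' : u ≠ d.vertex) :
    (T.attach d w).rot u = T.rot u := by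
  simp [attach, h, h']

@[simp] theorem attach_verts (T : Tree) (d : Corner) (w : ℕ) :
    (T.attach d w).verts = insert w T.verts := rfl

theorem flatMap_splitEntry_of_forall_ne {a : Option ℕ} {w : ℕ} {l : List (Option ℕ × Colour)}
    (h : ∀ e ∈ l, e.1 ≠ a) : l.flatMap (splitEntry a w) = l := by
  induction l with
  | nil => rfl
  | cons e l ih =>
    rw [List.flatMap_cons, ih fun e he => h e (List.mem_cons_of_mem _ he)]
    simp [splitEntry, h e]

theorem mem_map_fst_flatMap_splitEntry {a x : Option ℕ} {w : ℕ} {l : List (Option ℕ × Colour)} :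
    x ∈ (l.flatMap (splitEntry a w)).map Prod.fst ↔
      x ∈ l.map Prod.fst ∨ (x = some w ∧ a ∈ l.map Prod.fst) := by
  induction l with
  | nil => simp
  | cons e l ih =>
    rw [List.flatMap_cons, List.map_append, List.mem_append, ih]
    by_cases h : e.1 = a
    · simp only [splitEntry, h, if_true, List.map_cons, List.map_nil, List.mem_cons,
        List.not_mem_nil, or_false, true_or, and_true]
      tauto
    · have h' : ¬ a = e.1 := fun h'' => h h''.symm
      simp only [splitEntry, h, if_false, List.map_cons, List.map_nil, List.mem_cons,
        List.not_mem_nil, or_false, h', false_or]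
      tauto

theorem nodup_flatMap_splitEntry {a : Option ℕ} {w : ℕ} {l : List (Option ℕ × Colour)}
    (h : (l.map Prod.fst).Nodup) (hw : some w ∉ l.map Prod.fst) :
    ((l.flatMap (splitEntry a w)).map Prod.fst).Nodup := by
  induction l with
  | nil => simp
  | cons e l ih =>
    rw [List.map_cons, List.nodup_cons] at h
    rw [List.map_cons, List.mem_cons, not_or] at hw
    have ih := ih h.2 hw.2
    rw [List.flatMap_cons, List.map_append]
    by_cases hea : e.1 = a
    · have hl : l.flatMap (splitEntry a w) = l := by
        refine flatMap_splitEntry_of_forall_ne fun e' he' hh => h.1 ?_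
        rw [hea, ← hh]; exact List.mem_map_of_mem he'
      rw [hl]
      simp only [splitEntry, hea, if_true, List.map_cons, List.map_nil, List.cons_append,
        List.nil_append, List.nodup_cons, List.mem_cons, not_or]
      rw [← hea]
      exact ⟨⟨fun hh => hw.1 hh.symm, h.1⟩, hw.2, h.2⟩
    · simp only [splitEntry, hea, if_false, List.map_cons, List.map_nil, List.cons_append,
        List.nil_append, List.nodup_cons]
      refine ⟨fun hh => ?_, ih⟩
      have := mem_map_fst_flatMap_splitEntry.1 hh
      rcases this with hh | hh
      · exact h.1 hh
      · exact hw.1 hh.1.symm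

/-- Exactly one entry is split, as the half-edges are distinct; one part keeps the old colour, so
the gain is the weight of the other, blue part. -/
theorem sum_weight_flatMap_splitEntry (α : ℝ) {a : Option ℕ} {w : ℕ}
    {l : List (Option ℕ × Colour)} (h : (l.map Prod.fst).Nodup) (ha : a ∈ l.map Prod.fst) :
    ((l.flatMap (splitEntry a w)).map fun e => e.2.weight α).sum =
      (l.map fun e => e.2.weight α).sum + 1 := by
  induction l with
  | nil => simp at ha
  | cons e l ih =>
    rw [List.map_cons, List.nodup_cons] at h
    rw [List.flatMap_cons, List.map_append, List.sum_append]
    by_cases hea : e.1 = a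
    · have hl : l.flatMap (splitEntry a w) = l := by
        refine flatMap_splitEntry_of_forall_ne fun e' he' hh => h.1 ?_
        rw [hea, ← hh]; exact List.mem_map_of_mem he'
      rw [hl]
      simp [splitEntry, hea, Colour.weight]
      ring
    · rw [List.map_cons, List.mem_cons] at ha
      rw [ih h.2 (ha.resolve_left fun hh => hea hh.symm)]
      simp [splitEntry, hea]
      ring

/-- `T` is a planted plane tree with root `r` and coloured corners, the root having a red corner if
`χ` is red and none otherwise. -/
structure IsPlanted (χ : Colour) (r : ℕ) (T : Tree) : Prop where
  root_mem : r ∈ T.verts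
  -- The half-edge comes first, as in the list built by `sector`; this makes equality with `subtree`
  -- literal and not just up to rotation.
  head : ∃ χ' l, T.rot r = (none, χ') :: l
  eq_root : ∀ u, none ∈ T.ends u → u = r
  closed : ∀ u x, some x ∈ T.ends u → x ∈ T.verts
  loopless : ∀ u, some u ∉ T.ends u
  outside : ∀ u, u ∉ T.verts → T.rot u = []
  nodup : ∀ u, (T.ends u).Nodup
  -- Connectedness is not part of the structure; this identity is the only count of corners that the
  -- urn needs.
  weight : ∀ α, ∑ u ∈ T.verts, ((T.rot u).map fun e => e.2.weight α).sum =
    rescaled α χ T.verts.card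

theorem IsPlanted.vertex_mem {χ : Colour} {r : ℕ} {T : Tree} (h : T.IsPlanted χ r) {u : ℕ}
    {e : Option ℕ × Colour} (he : e ∈ T.rot u) : u ∈ T.verts := by
  by_contra hu
  rw [h.outside u hu] at he
  simp at he

theorem rescaled_add_one (α : ℝ) (χ : Colour) (m : ℕ) :
    rescaled α χ (m + 1) = rescaled α χ m + (1 + α) := by
  cases χ <;> simp [rescaled] <;> ring

theorem mem_ends_attach {T : Tree} {d : Corner} {w u : ℕ} {x : Option ℕ} (hw : w ∉ T.verts)
    (hd : d ∈ T.corners) :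
    x ∈ (T.attach d w).ends u ↔ (u = w ∧ x = some d.vertex) ∨ (u ≠ w ∧ x ∈ T.ends u) ∨
      (u = d.vertex ∧ x = some w) := by
  have hdv := (mem_corners.1 hd).1
  have hda : d.after ∈ T.ends d.vertex := mem_ends.2 ⟨_, (mem_corners.1 hd).2⟩
  have hne : d.vertex ≠ w := fun h => hw (h ▸ hdv)
  by_cases huw : u = w
  · subst huw
    simp [ends, attach_rot_new, hne.symm]
  by_cases hud : u = d.vertex
  · subst hud
    rw [ends, attach_rot_vertex _ _ huw, mem_map_fst_flatMap_splitEntry]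
    change _ ∨ (_ ∧ d.after ∈ T.ends d.vertex) ↔ _
    simp only [hda, ne_eq, huw, not_false_eq_true, true_and, false_and, false_or, and_true]
    rfl
  · rw [ends, attach_rot_other _ _ huw hud]
    simp [huw, hud, ends]

theorem IsPlanted.attach {χ : Colour} {r : ℕ} {T : Tree} (h : T.IsPlanted χ r) {d : Corner}
    (hd : d ∈ T.corners) {w : ℕ} (hw : w ∉ T.verts) : (T.attach d w).IsPlanted χ r := by
  have hdv := (mem_corners.1 hd).1
  have hda : d.after ∈ T.ends d.vertex := mem_ends.2 ⟨_, (mem_corners.1 hd).2⟩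
  have hne : d.vertex ≠ w := fun h => hw (h ▸ hdv)
  have hrw : r ≠ w := fun hh => hw (hh ▸ h.root_mem)
  refine ⟨by simp [h.root_mem], ?_, ?_, ?_, ?_, ?_, ?_, ?_⟩
  · obtain ⟨χ', l, hl⟩ := h.head
    by_cases hr : r = d.vertex
    · rw [hr] at hl ⊢
      rw [attach_rot_vertex _ _ hne, hl, List.flatMap_cons, splitEntry]
      split_ifs <;> simp
    · exact ⟨χ', l, by rw [attach_rot_other _ _ hrw hr, hl]⟩
  · intro u hu
    rw [mem_ends_attach hw hd] at hu
    simp only [reduceCtorEq, and_false, false_or, or_false] at hu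
    exact h.eq_root u hu.2
  · intro u x hx
    rw [mem_ends_attach hw hd] at hx
    rw [attach_verts, Finset.mem_insert]
    rcases hx with hx | hx | hx
    · simp only [Option.some.injEq] at hx
      exact Or.inr (hx.2 ▸ hdv)
    · exact Or.inr (h.closed u x hx.2)
    · simp only [Option.some.injEq] at hx
      exact Or.inl hx.2
  · intro u hu
    rw [mem_ends_attach hw hd] at hu
    rcases hu with hu | hu | hu
    · simp only [Option.some.injEq] at hu
      exact hne (hu.2.symm.trans hu.1)
    · exact h.loopless u hu.2
    · simp only [Option.some.injEq] at hu
      exact hne (hu.1.symm.trans hu.2)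
  · intro u hu
    rw [attach_verts, Finset.mem_insert, not_or] at hu
    rw [attach_rot_other _ _ hu.1 fun hh => hu.2 (hh ▸ hdv), h.outside u hu.2]
  · intro u
    by_cases huw : u = w
    · subst huw; simp [ends, attach_rot_new]
    by_cases hud : u = d.vertex
    · subst hud
      rw [ends, attach_rot_vertex _ _ huw]
      exact nodup_flatMap_splitEntry (h.nodup _) fun hh => hw (h.closed _ _ hh)
    · rw [ends, attach_rot_other _ _ huw hud]
      exact h.nodup u
  · intro α
    -- The increment `1 + α` is the red corner of the new vertex plus the blue part of the split
    -- corner.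
    rw [attach_verts, Finset.sum_insert hw, Finset.card_insert_of_notMem hw, rescaled_add_one,
      ← h.weight α, attach_rot_new, ← Finset.add_sum_erase _ _ hdv,
      ← Finset.add_sum_erase T.verts _ hdv, attach_rot_vertex _ _ hne,
      sum_weight_flatMap_splitEntry α (h.nodup _) hda]
    have : ∑ u ∈ T.verts.erase d.vertex,
        (((T.attach d w).rot u).map fun e => e.2.weight α).sum =
        ∑ u ∈ T.verts.erase d.vertex, ((T.rot u).map fun e => e.2.weight α).sum := by
      refine Finset.sum_congr rfl fun u hu => ?_
      rw [Finset.mem_erase] at hu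
      rw [attach_rot_other _ _ (ne_of_mem_of_not_mem hu.2 hw) hu.1]
    rw [this]
    simp [Colour.weight]
    ring

/-- The planted tree with the single vertex `r`, whose only corner has colour `χ`. -/
def sprout (r : ℕ) (χ : Colour) : Tree where
  verts := {r}
  rot u := if u = r then [(none, χ)] else []

theorem sprout_isPlanted (r : ℕ) (χ : Colour) : (sprout r χ).IsPlanted χ r := by
  refine ⟨by simp [sprout], ⟨χ, [], by simp [sprout]⟩, ?_, ?_, ?_, ?_, ?_, ?_⟩
  · intro u hu; by_contra h; simp [sprout, ends, h] at hu
  · intro u x hx; by_cases h : u = r <;> simp [sprout, ends, h] at hx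
  · intro u hx; by_cases h : u = r <;> simp [sprout, ends, h] at hx
  · intro u hu; simp [sprout] at hu; simp [sprout, hu]
  · intro u; by_cases h : u = r <;> simp [sprout, ends, h]
  · intro α; cases χ <;> simp [sprout, Colour.weight, rescaled]

theorem sprout_iso (r r' : ℕ) (χ : Colour) : (sprout r χ).Iso (sprout r' χ) := by
  refine ⟨Equiv.swap r r', by simp [sprout], fun u hu => ?_⟩
  simp only [sprout, Finset.mem_singleton] at hu
  subst hu
  simp [sprout]

/-- The total weight of the corners. -/
noncomputable def weightSum (α : ℝ) (T : Tree) : ℝ≥0∞ :=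
  ∑ d ∈ T.corners, ENNReal.ofReal (d.colour.weight α)

theorem _root_.PlanarPA.Colour.weight_pos {α : ℝ} (hα : 0 < α) (χ : Colour) : 0 < χ.weight α := by
  cases χ <;> simp [Colour.weight, hα]

/-- Kept general in `g` to serve both the total weight and the counts of all corners and of red
corners. -/
theorem sum_corners {M : Type*} [AddCommMonoid M] {T : Tree} (h : ∀ u ∈ T.verts, (T.ends u).Nodup)
    (g : Colour → M) :
    ∑ d ∈ T.corners, g d.colour = ∑ u ∈ T.verts, ((T.rot u).map fun e => g e.2).sum := by
  rw [corners, Finset.sum_biUnion]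
  · refine Finset.sum_congr rfl fun u hu => ?_
    rw [List.sum_toFinset, List.map_map]
    · rfl
    · refine List.Nodup.map_on ?_ (List.Nodup.of_map _ (h u hu))
      intro x _ y _ hxy
      simp only [Corner.mk.injEq, true_and] at hxy
      exact Prod.ext hxy.1 hxy.2
  · intro u _ v _ huv
    rw [Function.onFun, Finset.disjoint_left]
    intro d hd hd'
    simp only [List.mem_toFinset, List.mem_map] at hd hd'
    obtain ⟨e, -, rfl⟩ := hd
    obtain ⟨e', -, he'⟩ := hd'
    exact huv (congrArg Corner.vertex he').symm

theorem IsPlanted.weightSum_eq {χ : Colour} {r : ℕ} {T : Tree} (h : T.IsPlanted χ r) {α : ℝ}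
    (hα : 0 < α) : T.weightSum α = ENNReal.ofReal (rescaled α χ T.verts.card) := by
  rw [weightSum, ← ENNReal.ofReal_sum_of_nonneg fun d _ => (Colour.weight_pos hα _).le,
    sum_corners fun u _ => h.nodup u, h.weight]

theorem IsPlanted.rescaled_pos {χ : Colour} {r : ℕ} {T : Tree} (h : T.IsPlanted χ r) {α : ℝ}
    (hα : 0 < α) : 0 < rescaled α χ T.verts.card := by
  have h1 : (1 : ℝ) ≤ T.verts.card := by
    exact_mod_cast Finset.card_pos.2 ⟨r, h.root_mem⟩
  cases χ <;> simp only [rescaled] <;> nlinarith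

/-! ### Relabelling commutes with attachment -/

section IsoAttach

/-- Relabelling of a corner. -/
def _root_.PlanarPA.Corner.relabel (f : Equiv.Perm ℕ) (d : Corner) : Corner :=
  ⟨f d.vertex, d.after.map f, d.colour⟩

theorem _root_.PlanarPA.Corner.relabel_injective (f : Equiv.Perm ℕ) :
    Function.Injective (Corner.relabel f) := by
  rintro ⟨v, a, χ⟩ ⟨v', a', χ'⟩ h
  simp only [Corner.relabel, Corner.mk.injEq, EmbeddingLike.apply_eq_iff_eq] at h
  simp [h.1, h.2.2, Option.map_injective f.injective h.2.1]

/-- `f` relabels `T` into `T'`. -/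
def IsRelabelling (f : Equiv.Perm ℕ) (T T' : Tree) : Prop :=
  T'.verts = T.verts.map f.toEmbedding ∧
    ∀ u ∈ T.verts, (T.rot u).map (Prod.map (Option.map f) id) ~r T'.rot (f u)

theorem IsRelabelling.mem_corners {f : Equiv.Perm ℕ} {T T' : Tree} (h : IsRelabelling f T T')
    {d : Corner} (hd : d ∈ T.corners) : d.relabel f ∈ T'.corners := by
  rw [Tree.mem_corners] at hd ⊢
  refine ⟨by simpa [h.1, Corner.relabel] using hd.1, ?_⟩
  rw [Corner.relabel, ← (h.2 _ hd.1).mem_iff]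
  exact List.mem_map.2 ⟨_, hd.2, rfl⟩

theorem IsRelabelling.corners_eq {f : Equiv.Perm ℕ} {T T' : Tree} (h : IsRelabelling f T T') :
    T'.corners = T.corners.map ⟨Corner.relabel f, Corner.relabel_injective f⟩ := by
  ext d
  simp only [Finset.mem_map, Function.Embedding.coeFn_mk]
  constructor
  · intro hd
    have hd' := hd
    rw [Tree.mem_corners, h.1] at hd
    obtain ⟨u, hu, hud⟩ := Finset.mem_map.1 hd.1
    rw [Equiv.coe_toEmbedding] at hud
    have h2 := hd.2
    rw [← hud, ← (h.2 u hu).mem_iff] at h2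
    obtain ⟨⟨x, χ⟩, he, hee⟩ := List.mem_map.1 h2
    refine ⟨⟨u, x, χ⟩, Tree.mem_corners.2 ⟨hu, he⟩, ?_⟩
    simp only [Prod.map_apply, id_eq, Prod.mk.injEq] at hee
    obtain ⟨v, a, c⟩ := d
    simp_all [Corner.relabel]
  · rintro ⟨d, hd, rfl⟩
    exact h.mem_corners hd

theorem _root_.List.IsRotated.flatMap {β γ : Type*} {l l' : List β} (h : l ~r l') (f : β → List γ) :
    l.flatMap f ~r l'.flatMap f := by
  obtain ⟨n, rfl⟩ := h
  rw [← List.rotate_mod]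
  by_cases hl : l = []
  · simp [hl]
  have hn := (Nat.mod_lt n (List.length_pos_iff.2 hl)).le
  rw [List.rotate_eq_drop_append_take hn, List.flatMap_append]
  conv_lhs => rw [← List.take_append_drop (n % l.length) l, List.flatMap_append]
  exact List.isRotated_append

/-- The labels `w` and `w'` are arbitrary fresh ones: a new vertex is numbered by the size of the
whole tree, which differs from the number it would get in a planted tree grown on its own. -/
theorem IsRelabelling.attach {f : Equiv.Perm ℕ} {T T' : Tree} (h : IsRelabelling f T T')
    (hT : ∀ u x, some x ∈ T.ends u → x ∈ T.verts) {d : Corner} (hd : d ∈ T.corners) {w w' : ℕ}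
    (hw : w ∉ T.verts) (hw' : w' ∉ T'.verts) :
    (T.attach d w).Iso (T'.attach (d.relabel f) w') := by
  have hdv := (Tree.mem_corners.1 hd).1
  -- `f` need not send `w` to `w'`. The transposition repairs this and fixes the images of all old
  -- vertices, among which neither `f w` nor `w'` occurs.
  set g : Equiv.Perm ℕ := f.trans (Equiv.swap (f w) w') with hg
  have hgw : g w = w' := by simp [hg]
  have hgu : ∀ u ∈ T.verts, g u = f u := by
    intro u hu
    have h1 : f u ≠ f w := fun hh => hw (f.injective hh ▸ hu)
    have h2 : f u ≠ w' := by
      rintro rfl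
      exact hw' (by simpa [h.1] using hu)
    simp [hg, Equiv.swap_apply_of_ne_of_ne h1 h2]
  have hgo : ∀ u, ∀ e ∈ T.rot u, Option.map g e.1 = Option.map f e.1 := by
    rintro u ⟨x, χ⟩ he
    cases x with
    | none => rfl
    | some x => simp [hgu x (hT u x (mem_ends.2 ⟨χ, he⟩))]
  have hne : d.vertex ≠ w := fun hh => hw (hh ▸ hdv)
  have hmap : ∀ u, (T.rot u).map (Prod.map (Option.map g) id) =
      (T.rot u).map (Prod.map (Option.map f) id) := by
    intro u
    refine List.map_congr_left fun e he => ?_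
    simp [Prod.map, hgo u e he]
  have hw'f : ∀ u ∈ T.verts, f u ≠ w' := fun u hu hh => hw' (by
    rw [← hh, h.1]; simpa using hu)
  refine ⟨g, ?_, fun u hu => ?_⟩
  · rw [attach_verts, attach_verts, h.1, Finset.map_insert, Equiv.coe_toEmbedding, hgw]
    congr 1
    ext x
    simp only [Finset.mem_map, Equiv.coe_toEmbedding]
    exact exists_congr fun a => and_congr_right fun ha => by rw [hgu a ha]
  · by_cases huw : u = w
    · subst huw
      rw [attach_rot_new, hgw, attach_rot_new]
      simp [Corner.relabel, hgu _ hdv]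
    have huT : u ∈ T.verts := by simpa [huw] using hu
    by_cases hud : u = d.vertex
    · subst hud
      have hr : (d.relabel f).vertex = f d.vertex := rfl
      rw [attach_rot_vertex _ _ hne, hgu _ huT, ← hr, attach_rot_vertex _ _ (hw'f _ huT)]
      refine List.IsRotated.trans ?_ ((h.2 _ huT).flatMap _)
      rw [List.map_flatMap, List.flatMap_map]
      convert List.IsRotated.refl _ using 1
      rw [List.flatMap_def, List.flatMap_def]
      congr 1
      refine List.map_congr_left fun e he => ?_
      have he1 := hgo _ e he
      by_cases hea : e.1 = d.after
      · rw [hea] at he1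
        simp [splitEntry, hea, Corner.relabel, hgw, he1]
      · have : ¬ Option.map f e.1 = Option.map f d.after := fun hh =>
          hea (Option.map_injective f.injective hh)
        simp [splitEntry, hea, Corner.relabel, this, he1, Prod.map]
    · rw [attach_rot_other _ _ huw hud, hmap, hgu _ huT, attach_rot_other _ _ (hw'f _ huT)]
      · exact h.2 u huT
      · simp [Corner.relabel, hud]

end IsoAttach

/-! ### Decomposition of a grown tree into planted trees -/

theorem IsColouredPlaneTree.entry {S : Tree} (hS : S.IsColouredPlaneTree) {v : ℕ}
    {e : Option ℕ × Colour} (he : e ∈ S.rot v) : v ∈ S.verts ∧ ∃ x ∈ S.verts, e.1 = some x := by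
  have hv : v ∈ S.verts := by
    by_contra hv
    rw [hS.outside v hv] at he
    simp at he
  obtain ⟨x, hx, -, hx'⟩ := (hS.ends_eq v hv e.1).1 (List.mem_map_of_mem he)
  exact ⟨hv, x, hx, hx'⟩

theorem IsColouredPlaneTree.corner_after {S : Tree} (hS : S.IsColouredPlaneTree) {c : Corner}
    (hc : c ∈ S.corners) : ∃ x ∈ S.verts, c.after = some x :=
  (hS.entry (mem_corners.1 hc).2).2

theorem IsColouredPlaneTree.corner_ext {S : Tree} (hS : S.IsColouredPlaneTree) {c c' : Corner}
    (hc : c ∈ S.corners) (hc' : c' ∈ S.corners) (hv : c.vertex = c'.vertex)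
    (ha : c.after = c'.after) : c = c' := by
  rw [mem_corners] at hc hc'
  obtain ⟨v, a, χ⟩ := c
  obtain ⟨v', a', χ'⟩ := c'
  simp only at hc hc' hv ha
  subst hv ha
  have := List.inj_on_of_nodup_map (hS.nodup v hc.1) hc.2 hc'.2 rfl
  simp only [Prod.mk.injEq, true_and] at this
  rw [this]

/-- The block of half-edges that replaces an entry of the seed when a planted tree with
surroundings `l` of the root is glued into its corner. -/
def unplant (x : Option ℕ) (l : List (Option ℕ × Colour)) : List (Option ℕ × Colour) :=
  l.map (Prod.map (·.or x) id)

/-- `T` is obtained from the seed `S` by gluing the planted tree `P c` into each corner `c`. -/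
structure Glued (S T : Tree) (P : Corner → Tree) : Prop where
  planted : ∀ c ∈ S.corners, (P c).IsPlanted c.colour c.vertex
  mem_verts : ∀ u, u ∈ T.verts ↔ u ∈ S.verts ∨ ∃ c ∈ S.corners, u ∈ (P c).verts
  notMem_seed : ∀ c ∈ S.corners, ∀ u ∈ (P c).verts, u ≠ c.vertex → u ∉ S.verts
  eq_of_mem : ∀ c ∈ S.corners, ∀ c' ∈ S.corners, ∀ u ∈ (P c).verts, u ∈ (P c').verts →
    u ∉ S.verts → c = c'
  rot_seed : ∀ v ∈ S.verts, T.rot v =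
    (S.rot v).flatMap fun e => unplant e.1 ((P ⟨v, e.1, e.2⟩).rot v)
  rot_branch : ∀ c ∈ S.corners, ∀ u ∈ (P c).verts, u ≠ c.vertex → T.rot u = (P c).rot u
  outside : ∀ u, u ∉ T.verts → T.rot u = []
  -- Carried along because `IsDescendant` asks for such a path. That it stays in `T.verts` ensures
  -- that it can be extended by a new vertex.
  path : ∀ c ∈ S.corners, ∀ u ∈ (P c).verts, u ≠ c.vertex → ∃ p : T.graph.Walk u c.vertex,
    p.IsPath ∧ (∀ x ∈ p.support, x ∈ T.verts ∧ (x ∈ S.verts → x = c.vertex)) ∧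
    some p.penultimate ∈ (P c).ends c.vertex

theorem Glued.refl {S : Tree} (hS : S.IsColouredPlaneTree) :
    Glued S S fun c => sprout c.vertex c.colour := by
  have hv : ∀ c : Corner, (sprout c.vertex c.colour).verts = {c.vertex} := fun _ => rfl
  refine ⟨fun c _ => sprout_isPlanted _ _, ?_, ?_, ?_, ?_, ?_, hS.outside, ?_⟩
  · intro u
    simp only [hv, Finset.mem_singleton]
    refine ⟨Or.inl, ?_⟩
    rintro (h | ⟨c, hc, rfl⟩)
    · exact h
    · exact (mem_corners.1 hc).1
  · intro c _ u hu huc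
    exact absurd (by simpa [hv] using hu) huc
  · intro c hc c' _ u hu _ huS
    simp only [hv, Finset.mem_singleton] at hu
    exact absurd (hu ▸ (mem_corners.1 hc).1) huS
  · intro v _
    simp [sprout, unplant]
  · intro c _ u hu huc
    exact absurd (by simpa [hv] using hu) huc
  · intro c _ u hu huc
    exact absurd (by simpa [hv] using hu) huc

section Glued

variable {S T : Tree} {P : Corner → Tree}

theorem Glued.vertex_mem (h : Glued S T P) {c d : Corner} (hc : c ∈ S.corners)
    (hd : d ∈ (P c).corners) : d.vertex = c.vertex ∨ d.vertex ∉ S.verts := by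
  by_cases hh : d.vertex = c.vertex
  · exact Or.inl hh
  · exact Or.inr (h.notMem_seed c hc _ (mem_corners.1 hd).1 hh)

/-- Without loops, a neighbour of the root is not the root, hence not in the seed. This separates
half-edges of the seed from later ones. -/
theorem Glued.eq_none_or (h : Glued S T P) {c : Corner} (hc : c ∈ S.corners)
    {u : ℕ} {x : Option ℕ} (hx : x ∈ (P c).ends u) (hu : u = c.vertex) :
    x = none ∨ ∃ y, x = some y ∧ y ∈ (P c).verts ∧ y ∉ S.verts := by
  cases x with
  | none => exact Or.inl rfl
  | some y =>
    refine Or.inr ⟨y, rfl, (h.planted c hc).closed u y hx, ?_⟩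
    refine h.notMem_seed c hc y ((h.planted c hc).closed u y hx) ?_
    rintro rfl
    exact (h.planted c hc).loopless u (hu ▸ hx)

/-- The corner of `T` that corresponds to a corner of the planted tree glued into `c`. -/
def lift (c d : Corner) : Corner := ⟨d.vertex, d.after.or c.after, d.colour⟩

theorem Glued.lift_mem (h : Glued S T P) {c d : Corner} (hc : c ∈ S.corners)
    (hd : d ∈ (P c).corners) : lift c d ∈ T.corners := by
  have hd' := mem_corners.1 hd
  rw [mem_corners]
  refine ⟨(h.mem_verts _).2 (Or.inr ⟨c, hc, hd'.1⟩), ?_⟩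
  have hc' := mem_corners.1 hc
  by_cases hdc : d.vertex = c.vertex
  · simp only [lift, hdc]
    rw [hdc] at hd'
    rw [h.rot_seed _ hc'.1, List.mem_flatMap]
    exact ⟨_, hc'.2, List.mem_map.2 ⟨_, hd'.2, rfl⟩⟩
  · simp only [lift]
    rw [h.rot_branch c hc _ hd'.1 hdc]
    have : d.after ≠ none := fun hh =>
      hdc ((h.planted c hc).eq_root _ (hh ▸ mem_ends.2 ⟨_, hd'.2⟩))
    obtain ⟨x, hx⟩ := Option.ne_none_iff_exists'.1 this
    rw [hx]
    rw [hx] at hd'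
    exact hd'.2

theorem Glued.exists_lift_eq (h : Glued S T P) {d : Corner}
    (hd : d ∈ T.corners) : ∃ c ∈ S.corners, ∃ d' ∈ (P c).corners, lift c d' = d := by
  obtain ⟨v, a, χ⟩ := d
  have hd' := mem_corners.1 hd
  simp only at hd'
  by_cases hv : v ∈ S.verts
  · rw [h.rot_seed v hv, List.mem_flatMap] at hd'
    obtain ⟨-, e, he, hh⟩ := hd'
    have hc : (⟨v, e.1, e.2⟩ : Corner) ∈ S.corners := mem_corners.2 ⟨hv, he⟩
    obtain ⟨⟨x, χ'⟩, hx, hxx⟩ := List.mem_map.1 hh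
    simp only [Prod.map_apply, id_eq, Prod.mk.injEq] at hxx
    refine ⟨_, hc, ⟨v, x, χ'⟩, mem_corners.2 ⟨(h.planted _ hc).root_mem, hx⟩, ?_⟩
    simp [lift, hxx]
  · obtain ⟨c, hc, hvc⟩ := ((h.mem_verts v).1 hd'.1).resolve_left hv
    have hne : v ≠ c.vertex := fun hh => hv (hh ▸ (mem_corners.1 hc).1)
    rw [h.rot_branch c hc v hvc hne] at hd'
    refine ⟨c, hc, ⟨v, a, χ⟩, mem_corners.2 ⟨hvc, hd'.2⟩, ?_⟩
    have : a ≠ none := fun hh => hne ((h.planted c hc).eq_root _ (hh ▸ mem_ends.2 ⟨_, hd'.2⟩))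
    obtain ⟨x, rfl⟩ := Option.ne_none_iff_exists'.1 this
    rfl

/-- A half-edge at a seed vertex determines its block: if it belongs to the seed it is where the
corner begins, and otherwise it leads to a vertex lying in only one planted tree. -/
theorem Glued.eq_of_or_eq (h : Glued S T P) (hS : S.IsColouredPlaneTree) {c c' : Corner}
    (hc : c ∈ S.corners) (hc' : c' ∈ S.corners) (hv : c.vertex = c'.vertex) {x x' : Option ℕ}
    (hx : x ∈ (P c).ends c.vertex) (hx' : x' ∈ (P c').ends c'.vertex)
    (hxx : x.or c.after = x'.or c'.after) : c = c' ∧ x = x' := by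
  obtain ⟨y, hy, hya⟩ := hS.corner_after hc
  obtain ⟨y', hy', hya'⟩ := hS.corner_after hc'
  rcases h.eq_none_or hc hx rfl with rfl | ⟨z, rfl, hz, hzS⟩ <;>
    rcases h.eq_none_or hc' hx' rfl with rfl | ⟨z', rfl, hz', hzS'⟩
  · exact ⟨hS.corner_ext hc hc' hv (by simpa using hxx), rfl⟩
  · simp only [hya, Option.none_or, Option.some_or, Option.some.injEq] at hxx
    exact absurd (hxx ▸ hy) hzS'
  · simp only [hya', Option.none_or, Option.some_or, Option.some.injEq] at hxx
    exact absurd (hxx ▸ hy') hzS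
  · simp only [Option.some_or, Option.some.injEq] at hxx
    subst hxx
    exact ⟨h.eq_of_mem c hc c' hc' z hz hz' hzS, rfl⟩

theorem Glued.lift_inj (h : Glued S T P) (hS : S.IsColouredPlaneTree) {c c' d d' : Corner}
    (hc : c ∈ S.corners) (hc' : c' ∈ S.corners) (hd : d ∈ (P c).corners)
    (hd' : d' ∈ (P c').corners) (hh : lift c d = lift c' d') : c = c' ∧ d = d' := by
  have hdm := mem_corners.1 hd
  have hdm' := mem_corners.1 hd'
  have hdv := h.vertex_mem hc hd
  have hdv' := h.vertex_mem hc' hd'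
  obtain ⟨v, a, χ⟩ := d
  obtain ⟨v', a', χ'⟩ := d'
  simp only [lift, Corner.mk.injEq] at hh hdm hdm' hdv hdv'
  obtain ⟨rfl, ha, rfl⟩ := hh
  have hcS := (mem_corners.1 hc).1
  have hcS' := (mem_corners.1 hc').1
  by_cases hv : v ∈ S.verts
  · have h1 := hdv.resolve_right (not_not.2 hv)
    have h2 := hdv'.resolve_right (not_not.2 hv)
    obtain ⟨rfl, rfl⟩ := h.eq_of_or_eq hS hc hc' (h1.symm.trans h2)
      (h1 ▸ mem_ends.2 ⟨_, hdm.2⟩) (h2 ▸ mem_ends.2 ⟨_, hdm'.2⟩) ha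
    exact ⟨rfl, rfl⟩
  · obtain rfl := h.eq_of_mem c hc c' hc' v hdm.1 hdm'.1 hv
    have hne : v ≠ c.vertex := fun hh => hv (hh ▸ hcS)
    have key : ∀ a, (a, χ) ∈ (P c).rot v → ∃ x, a = some x := fun a ha =>
      Option.ne_none_iff_exists'.1 fun hh =>
        hne ((h.planted c hc).eq_root _ (hh ▸ mem_ends.2 ⟨_, ha⟩))
    obtain ⟨x, rfl⟩ := key a hdm.2
    obtain ⟨x', rfl⟩ := key a' hdm'.2
    simp only [Option.some_or] at ha
    exact ⟨rfl, by rw [ha]⟩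

/-- `lift` is a bijection from the disjoint union of the corners of the planted trees. As it keeps
colours, drawing a corner of `T` amounts to drawing `c` and then a corner of `P c`. -/
theorem Glued.sum_corners (h : Glued S T P) (hS : S.IsColouredPlaneTree) {M : Type*}
    [AddCommMonoid M] (g : Corner → M) :
    ∑ d ∈ T.corners, g d = ∑ c ∈ S.corners, ∑ d ∈ (P c).corners, g (lift c d) := by
  rw [Finset.sum_sigma']
  symm
  refine Finset.sum_bij (fun x _ => lift x.1 x.2) ?_ ?_ ?_ fun _ _ => rfl
  · intro x hx
    rw [Finset.mem_sigma] at hx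
    exact h.lift_mem hx.1 hx.2
  · rintro ⟨c, d⟩ hx ⟨c', d'⟩ hx' hh
    rw [Finset.mem_sigma] at hx hx'
    obtain ⟨h1, h2⟩ := h.lift_inj hS hx.1 hx'.1 hx.2 hx'.2 hh
    simp only at h1 h2
    rw [h1, h2]
  · intro d hd
    obtain ⟨c, hc, d', hd', hh⟩ := h.exists_lift_eq hd
    exact ⟨⟨c, d'⟩, Finset.mem_sigma.2 ⟨hc, hd'⟩, hh⟩

theorem graph_adj {T : Tree} {u v : ℕ} :
    T.graph.Adj u v ↔ u ≠ v ∧ (some v ∈ T.ends u ∨ some u ∈ T.ends v) :=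
  SimpleGraph.fromRel_adj _ _ _

theorem attach_graph_le {T : Tree} {d : Corner} {w : ℕ} (hw : w ∉ T.verts)
    (hd : d ∈ T.corners) (hT : ∀ u, u ∉ T.verts → T.rot u = []) :
    T.graph ≤ (T.attach d w).graph := by
  have key : ∀ u x, x ∈ T.ends u → x ∈ (T.attach d w).ends u := by
    intro u x hx
    refine (mem_ends_attach hw hd).2 (Or.inr (Or.inl ⟨?_, hx⟩))
    rintro rfl
    simp [ends, hT u hw] at hx
  intro u v huv
  rw [graph_adj] at huv ⊢
  exact ⟨huv.1, huv.2.imp (key _ _) (key _ _)⟩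

theorem Glued.subset (h : Glued S T P) {u : ℕ} (hu : u ∈ S.verts) : u ∈ T.verts :=
  (h.mem_verts u).2 (Or.inl hu)

theorem flatMap_unplant_splitEntry {x a : Option ℕ} {w : ℕ} {l : List (Option ℕ × Colour)}
    (hl : ∀ e ∈ l, e.1.or x = a.or x → e.1 = a) :
    (unplant x l).flatMap (splitEntry (a.or x) w) = unplant x (l.flatMap (splitEntry a w)) := by
  rw [unplant, unplant, List.map_flatMap, List.flatMap_map, List.flatMap_def, List.flatMap_def]
  congr 1
  refine List.map_congr_left fun e he => ?_
  by_cases hea : e.1 = a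
  · simp [splitEntry, hea]
  · have : ¬ e.1.or x = a.or x := fun hh => hea (hl e he hh)
    simp [splitEntry, hea, this]

/-- The induction step of the decomposition: growth at a corner lying in `c` changes only the
planted tree at `c`, and changes it by the same rule. -/
theorem Glued.attach (h : Glued S T P) (hS : S.IsColouredPlaneTree) {c d : Corner}
    (hc : c ∈ S.corners) (hd : d ∈ (P c).corners) {w : ℕ} (hw : w ∉ T.verts) :
    Glued S (T.attach (lift c d) w) (Function.update P c ((P c).attach d w)) := by
  have hPw : ∀ c' ∈ S.corners, w ∉ (P c').verts := fun c' hc' hh =>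
    hw ((h.mem_verts w).2 (Or.inr ⟨c', hc', hh⟩))
  have hwS : w ∉ S.verts := fun hh => hw (h.subset hh)
  have hdm := mem_corners.1 hd
  have hdw : d.vertex ≠ w := ne_of_mem_of_not_mem hdm.1 (hPw c hc)
  have hdv := h.vertex_mem hc hd
  have hcS := (mem_corners.1 hc).1
  have hlm := h.lift_mem hc hd
  have hverts : ∀ c' u, u ∈ (Function.update P c ((P c).attach d w) c').verts ↔
      u ∈ (P c').verts ∨ (c' = c ∧ u = w) := by
    intro c' u
    by_cases hcc : c' = c
    · subst hcc; simp [or_comm]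
    · simp [hcc]
  have hrot : ∀ c' u, u ≠ w → (c' = c → u ≠ d.vertex) →
      (Function.update P c ((P c).attach d w) c').rot u = (P c').rot u := by
    intro c' u huw huc
    by_cases hcc : c' = c
    · subst hcc
      rw [Function.update_self, attach_rot_other _ _ huw (huc rfl)]
    · rw [Function.update_of_ne hcc]
  have hends : ∀ c' ∈ S.corners, ∀ u x, x ∈ (P c').ends u →
      x ∈ (Function.update P c ((P c).attach d w) c').ends u := by
    intro c' hc' u x hx
    by_cases hcc : c' = c
    · subst hcc
      rw [Function.update_self, mem_ends_attach (hPw _ hc) hd]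
      refine Or.inr (Or.inl ⟨?_, hx⟩)
      obtain ⟨χ, hχ⟩ := mem_ends.1 hx
      exact ne_of_mem_of_not_mem ((h.planted c' hc).vertex_mem hχ) (hPw _ hc)
    · rwa [Function.update_of_ne hcc]
  have hle := attach_graph_le hw hlm h.outside
  have hold : ∀ c' ∈ S.corners, ∀ u ∈ (P c').verts, u ≠ c'.vertex →
      ∃ p : (T.attach (lift c d) w).graph.Walk u c'.vertex, p.IsPath ∧
        (∀ x ∈ p.support, x ∈ T.verts ∧ (x ∈ S.verts → x = c'.vertex)) ∧
        some p.penultimate ∈ (Function.update P c ((P c).attach d w) c').ends c'.vertex := by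
    intro c' hc' u hu huc
    obtain ⟨p, hp1, hp2, hp3⟩ := h.path c' hc' u hu huc
    refine ⟨p.mapLe hle, (SimpleGraph.Walk.isPath_mapLe hle).2 hp1, ?_, ?_⟩
    · intro x hx
      rw [SimpleGraph.Walk.support_mapLe_eq_support] at hx
      exact hp2 x hx
    · have : (p.mapLe hle).penultimate = p.penultimate := by
        simp [SimpleGraph.Walk.penultimate, SimpleGraph.Walk.mapLe]
      rw [this]
      exact hends c' hc' _ _ hp3
  refine ⟨?_, ?_, ?_, ?_, ?_, ?_, ?_, ?_⟩
  · intro c' hc'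
    by_cases hcc : c' = c
    · subst hcc
      rw [Function.update_self]
      exact (h.planted c' hc').attach hd (hPw c' hc')
    · rw [Function.update_of_ne hcc]
      exact h.planted c' hc'
  · intro u
    simp only [hverts, attach_verts, Finset.mem_insert, h.mem_verts]
    constructor
    · rintro (rfl | hu | ⟨c', hc', hu⟩)
      · exact Or.inr ⟨c, hc, Or.inr ⟨rfl, rfl⟩⟩
      · exact Or.inl hu
      · exact Or.inr ⟨c', hc', Or.inl hu⟩
    · rintro (hu | ⟨c', hc', hu | hu⟩)
      · exact Or.inr (Or.inl hu)
      · exact Or.inr (Or.inr ⟨c', hc', hu⟩)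
      · exact Or.inl hu.2
  · intro c' hc' u hu huc
    rw [hverts] at hu
    rcases hu with hu | ⟨-, rfl⟩
    · exact h.notMem_seed c' hc' u hu huc
    · exact hwS
  · intro c₁ hc₁ c₂ hc₂ u hu₁ hu₂ huS
    rw [hverts] at hu₁ hu₂
    rcases hu₁ with hu₁ | ⟨rfl, rfl⟩ <;> rcases hu₂ with hu₂ | ⟨hcc, huw⟩
    · exact h.eq_of_mem c₁ hc₁ c₂ hc₂ u hu₁ hu₂ huS
    · exact absurd (huw ▸ hu₁) (hPw c₁ hc₁)
    · exact absurd hu₂ (hPw c₂ hc₂)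
    · exact hcc.symm
  · intro v hv
    have hvw : v ≠ w := ne_of_mem_of_not_mem hv hwS
    by_cases hvd : v = d.vertex
    · have hvc : v = c.vertex := by
        rw [hvd]; exact hdv.resolve_right (not_not.2 (hvd ▸ hv))
      have h1 : v = (lift c d).vertex := hvd
      have h2 : (T.attach (lift c d) w).rot v =
          (T.rot v).flatMap (splitEntry (lift c d).after w) := by
        rw [h1]
        exact attach_rot_vertex T (lift c d) hdw
      rw [h2, h.rot_seed v hv, List.flatMap_assoc, List.flatMap_def, List.flatMap_def]
      congr 1
      refine List.map_congr_left fun e he => ?_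
      have hc' : (⟨v, e.1, e.2⟩ : Corner) ∈ S.corners := mem_corners.2 ⟨hv, he⟩
      have hda : d.after ∈ (P c).ends c.vertex := by
        rw [← hvc, hvd]; exact mem_ends.2 ⟨_, hdm.2⟩
      have hea : ∀ e' ∈ (P ⟨v, e.1, e.2⟩).rot v, e'.1.or e.1 = d.after.or c.after →
          ⟨v, e.1, e.2⟩ = c ∧ e'.1 = d.after := fun e' he' hh =>
        h.eq_of_or_eq hS hc' hc hvc (mem_ends.2 ⟨e'.2, he'⟩) hda hh
      -- The surroundings of `v` are a concatenation of blocks, one per corner of the seed. By `hea`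
      -- the split half-edge occurs only in the block of `c`, and there only at the entry of `d`.
      by_cases hcc : (⟨v, e.1, e.2⟩ : Corner) = c
      · rw [hcc, Function.update_self]
        have hec : e.1 = c.after := by rw [← hcc]
        rw [hcc, hec] at hea
        have h3 : ((P c).attach d w).rot v = ((P c).rot v).flatMap (splitEntry d.after w) := by
          rw [hvd]
          exact attach_rot_vertex _ _ hdw
        rw [h3, hec]
        exact flatMap_unplant_splitEntry fun e' he' hh => (hea e' he' hh).2
      · rw [Function.update_of_ne hcc]
        refine flatMap_splitEntry_of_forall_ne fun e' he' hh => hcc ?_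
        obtain ⟨e'', he'', rfl⟩ := List.mem_map.1 he'
        exact (hea e'' he'' hh).1
    · rw [attach_rot_other T (lift c d) hvw hvd, h.rot_seed v hv]
      congr 1
      funext e
      rw [hrot _ _ hvw fun _ => hvd]
  · intro c' hc' u hu huc
    rw [hverts] at hu
    rcases hu with hu | ⟨rfl, rfl⟩
    · have huS := h.notMem_seed c' hc' u hu huc
      have huw : u ≠ w := ne_of_mem_of_not_mem hu (hPw c' hc')
      by_cases hud : u = d.vertex
      · have hcc : c = c' := h.eq_of_mem c hc c' hc' u (hud ▸ hdm.1) hu huS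
        subst hcc
        -- Away from the root there is no open half-edge, so `lift` changes nothing.
        have hda : d.after ≠ none := fun hh => huc ((h.planted c hc).eq_root _ (by
          rw [hud, ← hh]; exact mem_ends.2 ⟨_, hdm.2⟩))
        have hla : (lift c d).after = d.after := by
          obtain ⟨x, hx⟩ := Option.ne_none_iff_exists'.1 hda
          simp [lift, hx]
        rw [Function.update_self]
        have h2 : (T.attach (lift c d) w).rot u =
            (T.rot u).flatMap (splitEntry (lift c d).after w) := by
          rw [hud]
          exact attach_rot_vertex T (lift c d) hdw
        have h3 : ((P c).attach d w).rot u = ((P c).rot u).flatMap (splitEntry d.after w) := by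
          rw [hud]
          exact attach_rot_vertex _ _ hdw
        rw [h2, h3, hla, h.rot_branch c hc u hu huc]
      · rw [attach_rot_other T (lift c d) huw hud, hrot _ _ huw fun _ => hud,
          h.rot_branch c' hc' u hu huc]
    · rw [Function.update_self, attach_rot_new, attach_rot_new]
      rfl
  · intro u hu
    rw [attach_verts, Finset.mem_insert, not_or] at hu
    rw [attach_rot_other _ _ hu.1 (ne_of_mem_of_not_mem (mem_corners.1 hlm).1 hu.2).symm,
      h.outside u hu.2]
  · intro c' hc' u hu huc
    rw [hverts] at hu
    rcases hu with hu | ⟨rfl, rfl⟩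
    · obtain ⟨p, hp1, hp2, hp3⟩ := hold c' hc' u hu huc
      exact ⟨p, hp1, fun x hx => ⟨Finset.mem_insert_of_mem (hp2 x hx).1, (hp2 x hx).2⟩, hp3⟩
    · have hadj : (T.attach (lift c' d) u).graph.Adj u d.vertex := by
        refine graph_adj.2 ⟨hdw.symm, Or.inl ?_⟩
        rw [ends, attach_rot_new]
        simp [lift]
      -- The path of the new vertex is its edge followed by the path of `d.vertex`. If `d.vertex` is
      -- the root the edge is the whole path, and the penultimate vertex is the new one.
      by_cases hdc : d.vertex = c'.vertex
      · have hpen : some u ∈ ((P c').attach d u).ends c'.vertex :=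
          (mem_ends_attach (hPw c' hc) hd).2 (Or.inr (Or.inr ⟨hdc.symm, rfl⟩))
        rw [hdc] at hadj
        refine ⟨.cons hadj .nil, ?_, ?_, ?_⟩
        · simp [huc]
        · intro x hx
          simp only [SimpleGraph.Walk.support_cons, SimpleGraph.Walk.support_nil,
            List.mem_cons, List.not_mem_nil, or_false] at hx
          rcases hx with rfl | rfl
          · exact ⟨by simp, fun hh => absurd hh hwS⟩
          · exact ⟨Finset.mem_insert_of_mem (h.subset hcS), fun _ => rfl⟩
        · rw [Function.update_self]
          exact hpen
      · obtain ⟨p, hp1, hp2, hp3⟩ := hold c' hc' d.vertex hdm.1 hdc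
        refine ⟨.cons hadj p, ?_, ?_, ?_⟩
        · rw [SimpleGraph.Walk.cons_isPath_iff]
          exact ⟨hp1, fun hh => hw (hp2 u hh).1⟩
        · intro x hx
          rw [SimpleGraph.Walk.support_cons, List.mem_cons] at hx
          rcases hx with rfl | hx
          · exact ⟨by simp, fun hh => absurd hh hwS⟩
          · exact ⟨Finset.mem_insert_of_mem (hp2 x hx).1, (hp2 x hx).2⟩
        · rwa [SimpleGraph.Walk.penultimate_cons_of_not_nil]
          exact SimpleGraph.Walk.not_nil_of_ne hdc

/-- The surroundings of the vertex are blocks, each headed by a half-edge of the seed and otherwise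
leading to new vertices. Hence the scan starts at the head of the block of `c` and stops at the head
of the next block. -/
theorem Glued.sector_eq (h : Glued S T P) (hS : S.IsColouredPlaneTree) {c : Corner}
    (hc : c ∈ S.corners) : sector S T c = (P c).rot c.vertex := by
  obtain ⟨hcv, hcr⟩ := mem_corners.1 hc
  obtain ⟨s₁, s₂, hs⟩ := List.append_of_mem hcr
  obtain ⟨χ, l, hl⟩ := (h.planted c hc).head
  set blk : Option ℕ × Colour → List (Option ℕ × Colour) := fun e =>
    unplant e.1 ((P ⟨c.vertex, e.1, e.2⟩).rot c.vertex) with hblk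
  have hl' : ∀ e ∈ l, ∃ y, e.1 = some y ∧ y ∉ S.verts := by
    intro e he
    have hem : e.1 ∈ (P c).ends c.vertex := mem_ends.2 ⟨e.2, by rw [hl]; simp [he]⟩
    rcases h.eq_none_or hc hem rfl with h0 | ⟨y, hy, -, hyS⟩
    · have := (h.planted c hc).nodup c.vertex
      rw [ends, hl, List.map_cons, List.nodup_cons] at this
      exact absurd (by simpa [h0] using List.mem_map_of_mem (f := Prod.fst) he) this.1
    · exact ⟨y, hy, hyS⟩
  have hbc : blk (c.after, c.colour) = (c.after, χ) :: l := by
    simp only [hblk, unplant]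
    have : (P ⟨c.vertex, c.after, c.colour⟩).rot c.vertex = (none, χ) :: l := hl
    rw [this, List.map_cons]
    congr 1
    conv_rhs => rw [← List.map_id l]
    refine List.map_congr_left fun e he => ?_
    obtain ⟨y, hy, -⟩ := hl' e he
    exact Prod.ext (by simp [hy]) rfl
  have hrot : T.rot c.vertex = s₁.flatMap blk ++ ((c.after, χ) :: l ++ s₂.flatMap blk) := by
    rw [h.rot_seed _ hcv, hs, List.flatMap_append, List.flatMap_cons, ← hbc]
  have hpre : ∀ e ∈ s₁.flatMap blk, e.1 ≠ c.after := by
    intro e he hea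
    obtain ⟨e', he', hee⟩ := List.mem_flatMap.1 he
    have hc' : (⟨c.vertex, e'.1, e'.2⟩ : Corner) ∈ S.corners :=
      mem_corners.2 ⟨hcv, by rw [hs]; simp [he']⟩
    obtain ⟨e'', he'', rfl⟩ := List.mem_map.1 hee
    have := h.eq_of_or_eq hS hc' hc rfl (x := e''.1) (x' := none) (mem_ends.2 ⟨e''.2, he''⟩)
      (mem_ends.2 ⟨χ, by rw [hl]; simp⟩) (by simpa using hea)
    have h3 : e'.1 = c.after := congrArg Corner.after this.1
    have hnd := hS.nodup _ hcv
    rw [ends, hs, List.map_append, List.map_cons, List.nodup_append] at hnd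
    exact hnd.2.2 _ (List.mem_map_of_mem he') _ List.mem_cons_self h3
  have hnext : ∀ (s : List (Option ℕ × Colour)) (z : List (Option ℕ × Colour)), s ≠ [] →
      (∀ e ∈ s, e ∈ S.rot c.vertex) →
      (s.flatMap blk ++ z).takeWhile (fun e => e.1 ∉ S.verts.image some) = [] := by
    intro s z hs0 hsS
    obtain ⟨e, s', rfl⟩ := List.exists_cons_of_ne_nil hs0
    have he := hsS e List.mem_cons_self
    have hc' : (⟨c.vertex, e.1, e.2⟩ : Corner) ∈ S.corners := mem_corners.2 ⟨hcv, he⟩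
    obtain ⟨χ', l', hl'⟩ := (h.planted _ hc').head
    obtain ⟨-, x, hx, hex⟩ := hS.entry he
    have : blk e = (e.1, χ') :: unplant e.1 l' := by
      simp only [hblk]
      simp only at hl'
      rw [hl']
      rfl
    rw [List.flatMap_cons, this, List.cons_append, List.cons_append, List.takeWhile_cons_of_neg]
    simp [hex, hx]
  -- Doubling the list makes the scan cyclic. After the block of `c` there is always another one, if
  -- only a second copy of the same block when the vertex is a leaf of the seed.
  have hdrop : (T.rot c.vertex ++ T.rot c.vertex).dropWhile (fun e => e.1 ≠ c.after) =
      (c.after, χ) :: (l ++ ((s₂ ++ s₁ ++ [(c.after, c.colour)]).flatMap blk ++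
        s₂.flatMap blk)) := by
    rw [hrot, List.append_assoc, List.dropWhile_append_of_pos (by simpa using hpre)]
    simp [hbc]
  rw [sector, hdrop, hl]
  simp only
  congr 1
  rw [List.takeWhile_append_of_pos, hnext _ _ (by simp), List.append_nil]
  · intro e he
    rw [hs]
    simp only [List.mem_append, List.mem_cons, List.not_mem_nil, or_false] at he ⊢
    tauto
  · intro e he
    obtain ⟨y, hy, hyS⟩ := hl' e he
    simpa [hy] using hyS

theorem Glued.mem_of_adj (h : Glued S T P) {c : Corner} (hc : c ∈ S.corners) {u v : ℕ}
    (huv : T.graph.Adj u v) (hv : v ∈ (P c).verts) (huS : u ∉ S.verts) (hvS : v ∉ S.verts) :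
    u ∈ (P c).verts := by
  have key : ∀ x y, some y ∈ T.ends x → x ∉ S.verts →
      ∃ c' ∈ S.corners, x ∈ (P c').verts ∧ y ∈ (P c').verts := by
    intro x y hxy hx
    have hxT : x ∈ T.verts := by
      by_contra hxT
      simp [ends, h.outside x hxT] at hxy
    obtain ⟨c', hc', hxc⟩ := ((h.mem_verts x).1 hxT).resolve_left hx
    refine ⟨c', hc', hxc, (h.planted c' hc').closed x y ?_⟩
    rw [ends, ← h.rot_branch c' hc' x hxc fun hh => hx (hh ▸ (mem_corners.1 hc').1)]
    exact hxy
  rcases (graph_adj.1 huv).2 with hh | hh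
  · obtain ⟨c', hc', h1, h2⟩ := key u v hh huS
    rwa [h.eq_of_mem c hc c' hc' v hv h2 hvS]
  · obtain ⟨c', hc', h1, h2⟩ := key v u hh hvS
    rwa [h.eq_of_mem c hc c' hc' v hv h1 hvS]

/-- The last vertex before the root is a child of the root in `P c`, and edges between vertices
outside the seed do not leave `P c`. The endpoint `r` is a variable so that induction on the path
applies. -/
theorem Glued.mem_of_path (h : Glued S T P) {c : Corner} (hc : c ∈ S.corners) {u r : ℕ}
    (p : T.graph.Walk u r) (hr : r = c.vertex) (hp : p.IsPath) (hu : u ∉ S.verts)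
    (hpS : ∀ x ∈ p.support, x ∈ S.verts → x = c.vertex)
    (hpen : some p.penultimate ∈ (P c).ends c.vertex) : u ∈ (P c).verts := by
  induction p with
  | nil => exact absurd (hr ▸ (mem_corners.1 hc).1) hu
  | @cons u v r huv q ih =>
    rw [SimpleGraph.Walk.cons_isPath_iff] at hp
    by_cases hv : v ∈ S.verts
    · have hvr : v = r := (hpS v (by simp) hv).trans hr.symm
      subst hvr
      -- The rest of the path is closed, hence trivial, and so the penultimate vertex is `u`.
      rw [(SimpleGraph.Walk.isPath_iff_nil.1 hp.1).eq_nil] at hpen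
      exact (h.planted c hc).closed _ _ hpen
    · have hvr : v ≠ r := fun hh => hv (hh ▸ hr ▸ (mem_corners.1 hc).1)
      rw [SimpleGraph.Walk.penultimate_cons_of_not_nil _ _
        (SimpleGraph.Walk.not_nil_of_ne hvr)] at hpen
      refine h.mem_of_adj hc huv (ih hr hp.1 hv (fun x hx => hpS x ?_) hpen) hu hv
      rw [SimpleGraph.Walk.support_cons]
      exact List.mem_cons_of_mem _ hx

theorem Glued.isDescendant_iff (h : Glued S T P) (hS : S.IsColouredPlaneTree) {c : Corner}
    (hc : c ∈ S.corners) (u : ℕ) : IsDescendant S T c u ↔ u ∈ (P c).verts := by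
  have hs : (sector S T c).map Prod.fst = (P c).ends c.vertex := by
    rw [h.sector_eq hS hc]; rfl
  rw [IsDescendant, hs]
  constructor
  · rintro (rfl | ⟨hu, p, hp, hpS, hpen⟩)
    · exact (h.planted c hc).root_mem
    · exact h.mem_of_path hc p rfl hp (Finset.mem_sdiff.1 hu).2 hpS hpen
  · intro hu
    by_cases huc : u = c.vertex
    · exact Or.inl huc
    · obtain ⟨p, hp1, hp2, hp3⟩ := h.path c hc u hu huc
      exact Or.inr ⟨Finset.mem_sdiff.2 ⟨(h.mem_verts u).2 (Or.inr ⟨c, hc, hu⟩),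
        h.notMem_seed c hc u hu huc⟩, p, hp1, fun x hx => (hp2 x hx).2, hp3⟩

theorem Glued.subtree_eq (h : Glued S T P) (hS : S.IsColouredPlaneTree) {c : Corner}
    (hc : c ∈ S.corners) : subtree S T c = P c := by
  have hv : (subtree S T c).verts = (P c).verts := by
    ext u
    simp only [subtree, Finset.mem_filter, h.isDescendant_iff hS hc]
    exact ⟨fun hh => hh.2, fun hh => ⟨(h.mem_verts u).2 (Or.inr ⟨c, hc, hh⟩), hh⟩⟩
  have hr : (subtree S T c).rot = (P c).rot := by
    funext u
    simp only [subtree, h.isDescendant_iff hS hc]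
    split_ifs with h1 h2
    · rw [h.sector_eq hS hc, h1]
    · exact h.rot_branch c hc u h2.2 h1
    · refine ((h.planted c hc).outside u fun hu => h2 ?_).symm
      exact ⟨(h.mem_verts u).2 (Or.inr ⟨c, hc, hu⟩), hu⟩
  cases hsub : subtree S T c
  cases hP : P c
  simp_all

end Glued

/-! ### Counting the corners of a seed -/

open Classical in
theorem IsColouredPlaneTree.length_rot {S : Tree} (hS : S.IsColouredPlaneTree)
    (u : (S.verts : Set ℕ)) :
    (S.rot u).length = (S.graph.induce (S.verts : Set ℕ)).degree u := by
  have hu : (u : ℕ) ∈ S.verts := u.2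
  have h1 : (S.rot u).length = (S.ends u).toFinset.card := by
    rw [List.toFinset_card_of_nodup (hS.nodup u hu), ends, List.length_map]
  rw [h1, ← SimpleGraph.card_neighborFinset_eq_degree]
  symm
  refine Finset.card_bij (fun w _ => some (w : ℕ)) ?_ ?_ ?_
  · intro w hw
    rw [SimpleGraph.mem_neighborFinset] at hw
    rw [List.mem_toFinset, hS.ends_eq u hu]
    exact ⟨w, w.2, hw, rfl⟩
  · intro w _ w' _ hww
    exact Subtype.ext (Option.some.inj hww)
  · intro x hx
    rw [List.mem_toFinset, hS.ends_eq u hu] at hx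
    obtain ⟨w, hw, hadj, rfl⟩ := hx
    exact ⟨⟨w, hw⟩, by rw [SimpleGraph.mem_neighborFinset]; exact hadj, rfl⟩

/-- There are as many corners at a vertex as its degree, and the degrees sum to twice the number of
edges, which is one less than the number of vertices. -/
theorem IsColouredPlaneTree.card_corners {S : Tree} (hS : S.IsColouredPlaneTree) :
    S.corners.card + 2 = 2 * S.verts.card := by
  classical
  have h1 : S.corners.card = ∑ u ∈ S.verts, (S.rot u).length := by
    rw [Finset.card_eq_sum_ones, sum_corners hS.nodup fun _ => 1]
    simp
  have h2 : ∑ u ∈ S.verts, (S.rot u).length =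
      ∑ u : (S.verts : Set ℕ), (S.graph.induce (S.verts : Set ℕ)).degree u := by
    rw [← Finset.sum_coe_sort]
    exact Finset.sum_congr rfl fun u _ => hS.length_rot u
  have h3 := hS.isTree.card_edgeFinset
  rw [h1, h2, SimpleGraph.sum_degrees_eq_twice_card_edges]
  have h4 : Fintype.card (S.verts : Set ℕ) = S.verts.card := by simp
  rw [h4] at h3
  omega

theorem IsColouredPlaneTree.card_red {S : Tree} (hS : S.IsColouredPlaneTree) :
    (S.corners.filter fun d => d.colour = Colour.red).card = S.verts.card := by
  rw [Finset.card_filter, sum_corners hS.nodup fun χ => if χ = Colour.red then 1 else 0,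
    Finset.card_eq_sum_ones]
  refine Finset.sum_congr rfl fun u hu => ?_
  refine Eq.trans ?_ (hS.one_red u hu)
  generalize S.rot u = l
  induction l with
  | nil => rfl
  | cons e l ih =>
    rw [List.map_cons, List.sum_cons, ih, List.countP_cons, add_comm]
    simp

/-- The number of vertices determines the numbers of red and of blue corners, so the colour classes
can be matched separately. -/
theorem exists_corner_equiv {S S' : Tree} (hS : S.IsColouredPlaneTree)
    (hS' : S'.IsColouredPlaneTree) (h : S.verts.card = S'.verts.card) :
    ∃ φ : S.corners ≃ S'.corners, ∀ c, (φ c).1.colour = c.1.colour := by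
  have hc : ∀ T : Tree, ∀ χ, Fintype.card {c : T.corners // c.1.colour = χ} =
      (T.corners.filter fun d => d.colour = χ).card := by
    intro T χ
    rw [← Fintype.card_coe]
    exact Fintype.card_congr ⟨fun c => ⟨c.1.1, Finset.mem_filter.2 ⟨c.1.2, c.2⟩⟩,
      fun d => ⟨⟨d.1, (Finset.mem_filter.1 d.2).1⟩, (Finset.mem_filter.1 d.2).2⟩,
      fun _ => rfl, fun _ => rfl⟩
  have hb : ∀ T : Tree, (T.corners.filter fun d => d.colour = Colour.blue).card +
      (T.corners.filter fun d => d.colour = Colour.red).card = T.corners.card := by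
    intro T
    rw [add_comm, ← Finset.card_filter_add_card_filter_not (s := T.corners)
      (fun d => d.colour = Colour.red)]
    congr 2
    refine Finset.filter_congr fun d _ => ?_
    cases d.colour <;> simp
  have key : ∀ χ, Fintype.card {c : S.corners // c.1.colour = χ} =
      Fintype.card {c : S'.corners // c.1.colour = χ} := by
    intro χ
    rw [hc, hc]
    have h1 := hS.card_corners
    have h2 := hS'.card_corners
    have h3 := hS.card_red
    have h4 := hS'.card_red
    have h5 := hb S
    have h6 := hb S'
    cases χ <;> omega
  refine ⟨Equiv.ofFiberEquiv (f := fun c : S.corners => c.1.colour)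
    (g := fun c : S'.corners => c.1.colour) fun χ => Fintype.equivOfCardEq (key χ), fun c => ?_⟩
  exact Equiv.ofFiberEquiv_map (f := fun c : S.corners => c.1.colour)
    (g := fun c : S'.corners => c.1.colour) _ c

end Tree

/-! ### Expectations under discrete laws -/

section Expect

variable {X Y : Type*}

/-- The expectation of `F` under `p`. -/
noncomputable def expect (p : PMF X) (F : X → ℝ≥0∞) : ℝ≥0∞ := ∑' x, p x * F x

theorem expect_pure (x : X) (F : X → ℝ≥0∞) : expect (PMF.pure x) F = F x := by
  classical
  rw [expect, tsum_eq_single x]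
  · simp
  · intro y hy
    simp [PMF.pure_apply, hy]

theorem expect_bind (p : PMF X) (q : X → PMF Y) (F : Y → ℝ≥0∞) :
    expect (p.bind q) F = expect p fun x => expect (q x) F := by
  simp only [expect, PMF.bind_apply, ← ENNReal.tsum_mul_right, ← ENNReal.tsum_mul_left]
  rw [ENNReal.tsum_comm]
  simp only [mul_assoc]

theorem expect_map (p : PMF X) (f : X → Y) (F : Y → ℝ≥0∞) :
    expect (p.map f) F = expect p fun x => F (f x) := by
  rw [← PMF.bind_pure_comp, expect_bind]
  simp [expect_pure]

theorem expect_congr {p : PMF X} {F G : X → ℝ≥0∞} (h : ∀ x ∈ p.support, F x = G x) :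
    expect p F = expect p G := by
  refine tsum_congr fun x => ?_
  by_cases hx : p x = 0
  · simp [hx]
  · rw [h x ((p.mem_support_iff x).2 hx)]

theorem expect_zero (p : PMF X) : expect p (fun _ => 0) = 0 := by simp [expect]

theorem expect_const_mul (p : PMF X) (a : ℝ≥0∞) (F : X → ℝ≥0∞) :
    expect p (fun x => a * F x) = a * expect p F := by
  rw [expect, expect, ← ENNReal.tsum_mul_left]
  exact tsum_congr fun x => by ring

theorem expect_finset_sum {ι : Type*} (p : PMF X) (s : Finset ι) (F : ι → X → ℝ≥0∞) :
    expect p (fun x => ∑ i ∈ s, F i x) = ∑ i ∈ s, expect p (F i) := by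
  simp only [expect, Finset.mul_sum]
  exact Summable.tsum_finsetSum fun _ _ => ENNReal.summable

open Classical in
theorem toOuterMeasure_eq_expect (p : PMF X) (A : Set X) :
    p.toOuterMeasure A = expect p fun x => if x ∈ A then 1 else 0 := by
  rw [PMF.toOuterMeasure_apply, expect]
  refine tsum_congr fun x => ?_
  by_cases hx : x ∈ A <;> simp [hx]

end Expect

/-! ### One step of growth, and its action on the decomposition -/

namespace Tree

variable {α : ℝ}

theorem weightSum_ne_top (α : ℝ) (T : Tree) : T.weightSum α ≠ ⊤ :=
  ENNReal.sum_ne_top.2 fun _ _ => ENNReal.ofReal_ne_top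

theorem tsum_cornerWeight (α : ℝ) (T : Tree) : ∑' c, T.cornerWeight α c = T.weightSum α := by
  rw [tsum_eq_sum (s := T.corners) (fun c hc => by simp [cornerWeight, hc])]
  exact Finset.sum_congr rfl fun c hc => by simp [cornerWeight, hc]

/-- The law of the corner at which the next vertex is attached. -/
noncomputable def cornerLaw (α : ℝ) (T : Tree) (h : T.weightSum α ≠ 0) : PMF Corner :=
  PMF.normalize (T.cornerWeight α) (by rwa [tsum_cornerWeight]) (T.tsum_cornerWeight_ne_top α)

theorem step_eq {T : Tree} (h : T.weightSum α ≠ 0) :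
    T.step α = (T.cornerLaw α h).map fun d => T.attach d (T.verts.card + 1) := by
  rw [step, dif_pos (by rwa [tsum_cornerWeight])]
  rfl

theorem expect_cornerLaw {T : Tree} (h : T.weightSum α ≠ 0) (F : Corner → ℝ≥0∞) :
    expect (T.cornerLaw α h) F =
      (∑ d ∈ T.corners, ENNReal.ofReal (d.colour.weight α) * F d) / T.weightSum α := by
  rw [expect, tsum_eq_sum (s := T.corners), ENNReal.div_eq_inv_mul, Finset.mul_sum]
  · refine Finset.sum_congr rfl fun d hd => ?_
    rw [cornerLaw, PMF.normalize_apply, tsum_cornerWeight, cornerWeight, if_pos hd]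
    ring
  · intro d hd
    rw [cornerLaw, PMF.normalize_apply, cornerWeight, if_neg hd]
    simp

theorem expect_step {T : Tree} (h : T.weightSum α ≠ 0) (F : Tree → ℝ≥0∞) :
    expect (T.step α) F = (∑ d ∈ T.corners, ENNReal.ofReal (d.colour.weight α) *
      F (T.attach d (T.verts.card + 1))) / T.weightSum α := by
  rw [step_eq h, expect_map, expect_cornerLaw]

theorem mem_support_cornerLaw {T : Tree} (h : T.weightSum α ≠ 0) {d : Corner}
    (hd : d ∈ (T.cornerLaw α h).support) : d ∈ T.corners := by
  rw [cornerLaw, PMF.support_normalize, Function.mem_support] at hd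
  by_contra hh
  exact hd (by rw [cornerWeight, if_neg hh])

theorem mem_support_step {T T' : Tree} (h : T.weightSum α ≠ 0) (hT' : T' ∈ (T.step α).support) :
    ∃ d ∈ T.corners, T' = T.attach d (T.verts.card + 1) := by
  rw [step_eq h, PMF.mem_support_map_iff] at hT'
  obtain ⟨d, hd, rfl⟩ := hT'
  exact ⟨d, mem_support_cornerLaw h hd, rfl⟩

theorem IsPlanted.weightSum_ne_zero {χ : Colour} {r : ℕ} {T : Tree} (h : T.IsPlanted χ r)
    (hα : 0 < α) : T.weightSum α ≠ 0 := by
  rw [h.weightSum_eq hα]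
  simpa using h.rescaled_pos hα

theorem card_add_one_notMem {T : Tree} {n : ℕ} (h : T.verts = Finset.Icc 1 n) :
    T.verts.card + 1 ∉ T.verts := by
  rw [h]; simp

theorem insert_verts_eq {T : Tree} {n : ℕ} (h : T.verts = Finset.Icc 1 n) :
    insert (T.verts.card + 1) T.verts = Finset.Icc 1 (n + 1) := by
  rw [h, Nat.card_Icc, Nat.add_sub_cancel, Finset.insert_Icc_right_eq_Icc_add_one (by omega)]

theorem growth_bud_support (hα : 0 < α) (χ : Colour) (m : ℕ) :
    ∀ T ∈ (growth α (bud χ) m).support, T.IsPlanted χ 1 ∧ T.verts = Finset.Icc 1 (m + 1) := by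
  induction m with
  | zero =>
    intro T hT
    rw [growth, PMF.support_pure, Set.mem_singleton_iff] at hT
    subst hT
    exact ⟨sprout_isPlanted 1 χ, rfl⟩
  | succ m ih =>
    intro T hT
    rw [growth, PMF.mem_support_bind_iff] at hT
    obtain ⟨T₀, hT₀, hT⟩ := hT
    obtain ⟨h1, h2⟩ := ih T₀ hT₀
    obtain ⟨d, hd, rfl⟩ := mem_support_step (h1.weightSum_ne_zero hα) hT
    exact ⟨h1.attach hd (card_add_one_notMem h2), insert_verts_eq h2⟩

/-- `T` is a tree with vertices `1, …, n` that is obtained from the seed `S` by gluing planted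
trees into its corners. -/
def IsGrown (S : Tree) (n : ℕ) (T : Tree) : Prop :=
  T.verts = Finset.Icc 1 n ∧ Glued S T (subtree S T)

theorem Glued.congr {S T : Tree} {P Q : Corner → Tree} (h : Glued S T P)
    (hPQ : ∀ c ∈ S.corners, P c = Q c) : Glued S T Q where
  planted c hc := hPQ c hc ▸ h.planted c hc
  mem_verts u := by
    rw [h.mem_verts]
    exact or_congr_right (exists_congr fun c => and_congr_right fun hc => by rw [hPQ c hc])
  notMem_seed c hc := hPQ c hc ▸ h.notMem_seed c hc
  eq_of_mem c hc c' hc' := hPQ c hc ▸ hPQ c' hc' ▸ h.eq_of_mem c hc c' hc'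
  rot_seed v hv := by
    rw [h.rot_seed v hv, List.flatMap_def, List.flatMap_def]
    congr 1
    refine List.map_congr_left fun e he => ?_
    rw [hPQ _ (mem_corners.2 ⟨hv, he⟩)]
  rot_branch c hc := hPQ c hc ▸ h.rot_branch c hc
  outside := h.outside
  path c hc := hPQ c hc ▸ h.path c hc

/-- As the planted trees are determined by `S` and `T`, they need not be carried as data; `IsGrown`
becomes a property of `T` alone. -/
theorem Glued.glued_subtree {S T : Tree} {P : Corner → Tree} (h : Glued S T P)
    (hS : S.IsColouredPlaneTree) : Glued S T (subtree S T) :=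
  h.congr fun _ hc => (h.subtree_eq hS hc).symm

section Grown

variable {S T : Tree} {n k : ℕ}

theorem isGrown_self (hS : S.IsSeed k) : IsGrown S k S :=
  ⟨hS.verts_eq, (Glued.refl hS.tree).glued_subtree hS.tree⟩

theorem IsGrown.attach (h : IsGrown S n T) (hS : S.IsColouredPlaneTree) {c d : Corner}
    (hc : c ∈ S.corners) (hd : d ∈ (subtree S T c).corners) :
    IsGrown S (n + 1) (T.attach (lift c d) (T.verts.card + 1)) :=
  ⟨insert_verts_eq h.1, (h.2.attach hS hc hd (card_add_one_notMem h.1)).glued_subtree hS⟩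

theorem IsGrown.subtree_attach (h : IsGrown S n T) (hS : S.IsColouredPlaneTree) {c d c' : Corner}
    (hc : c ∈ S.corners) (hd : d ∈ (subtree S T c).corners) (hc' : c' ∈ S.corners) :
    subtree S (T.attach (lift c d) (T.verts.card + 1)) c' = Function.update (subtree S T) c
      ((subtree S T c).attach d (T.verts.card + 1)) c' :=
  (h.2.attach hS hc hd (card_add_one_notMem h.1)).subtree_eq hS hc'

theorem IsGrown.weightSum_eq (h : IsGrown S n T) (hS : S.IsColouredPlaneTree) :
    T.weightSum α = ∑ c ∈ S.corners, (subtree S T c).weightSum α := by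
  rw [weightSum, h.2.sum_corners hS]
  rfl

theorem IsGrown.weightSum_eq_rescaled (h : IsGrown S n T) (hS : S.IsColouredPlaneTree)
    (hα : 0 < α) : T.weightSum α =
      ∑ c ∈ S.corners, ENNReal.ofReal (rescaled α c.colour (subtreeSize S T c)) := by
  rw [h.weightSum_eq hS]
  exact Finset.sum_congr rfl fun c hc => (h.2.planted c hc).weightSum_eq hα

theorem IsGrown.weightSum_ne_zero (h : IsGrown S n T) (hS : S.IsColouredPlaneTree) (hα : 0 < α)
    (hne : S.corners.Nonempty) : T.weightSum α ≠ 0 := by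
  rw [h.weightSum_eq hS]
  obtain ⟨c, hc⟩ := hne
  intro h0
  exact (h.2.planted c hc).weightSum_ne_zero hα (Finset.sum_eq_zero_iff.1 h0 c hc)

theorem IsGrown.of_mem_support_step (h : IsGrown S n T) (hS : S.IsColouredPlaneTree) (hα : 0 < α)
    (hne : S.corners.Nonempty) {T' : Tree} (hT' : T' ∈ (T.step α).support) :
    IsGrown S (n + 1) T' := by
  obtain ⟨d, hd, rfl⟩ := mem_support_step (h.weightSum_ne_zero hS hα hne) hT'
  obtain ⟨c, hc, d', hd', rfl⟩ := h.2.exists_lift_eq hd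
  exact h.attach hS hc hd'

theorem growth_support (hS : S.IsSeed k) (hα : 0 < α) (hne : S.corners.Nonempty) (m : ℕ) :
    ∀ T ∈ (growth α S m).support, IsGrown S (k + m) T := by
  induction m with
  | zero =>
    intro T hT
    rw [growth, PMF.support_pure, Set.mem_singleton_iff] at hT
    subst hT
    exact isGrown_self hS
  | succ m ih =>
    intro T hT
    rw [growth, PMF.mem_support_bind_iff] at hT
    obtain ⟨T₀, hT₀, hT⟩ := hT
    exact (ih T₀ hT₀).of_mem_support_step hS.tree hα hne hT

theorem IsGrown.expect_step (h : IsGrown S n T) (hS : S.IsColouredPlaneTree) (hα : 0 < α)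
    (hne : S.corners.Nonempty) (F : Tree → ℝ≥0∞) :
    expect (T.step α) F = ∑ c ∈ S.corners, (∑ d ∈ (subtree S T c).corners,
      ENNReal.ofReal (d.colour.weight α) *
        F (T.attach (lift c d) (T.verts.card + 1))) / T.weightSum α := by
  rw [Tree.expect_step (h.weightSum_ne_zero hS hα hne), h.2.sum_corners hS]
  simp only [ENNReal.div_eq_inv_mul, Finset.mul_sum]
  rfl

end Grown

/-! ### Test functions invariant under relabelling -/

section Invariant

/-- `F` takes the same value on planted trees that differ by a relabelling. -/
def IsInvariant (F : Tree → ℝ≥0∞) : Prop :=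
  ∀ χ r r' T T', IsPlanted χ r T → IsPlanted χ r' T' → T.Iso T' → F T = F T'

/-- The expectation of `F` after one more step from a planted tree. -/
noncomputable def stepMean (α : ℝ) (F : Tree → ℝ≥0∞) (T : Tree) : ℝ≥0∞ :=
  (∑ d ∈ T.corners, ENNReal.ofReal (d.colour.weight α) * F (T.attach d (T.verts.sup id + 1))) /
    T.weightSum α

/-- A subtree has gaps in its labels, so its cardinality plus one may be taken; this label is always
free, and by invariance its choice is immaterial (`stepMean_eq`). -/
theorem sup_add_one_notMem (T : Tree) : T.verts.sup id + 1 ∉ T.verts := fun h => by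
  exact absurd (Finset.le_sup (f := id) h) (Nat.not_succ_le_self _)

theorem IsRelabelling.sum_attach {F : Tree → ℝ≥0∞} (hF : IsInvariant F) {χ : Colour} {r r' : ℕ}
    {f : Equiv.Perm ℕ} {T T' : Tree} (hT : T.IsPlanted χ r) (hT' : T'.IsPlanted χ r')
    (h : IsRelabelling f T T') {w w' : ℕ} (hw : w ∉ T.verts) (hw' : w' ∉ T'.verts) :
    ∑ d ∈ T.corners, ENNReal.ofReal (d.colour.weight α) * F (T.attach d w) =
      ∑ d ∈ T'.corners, ENNReal.ofReal (d.colour.weight α) * F (T'.attach d w') := by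
  rw [h.corners_eq, Finset.sum_map]
  refine Finset.sum_congr rfl fun d hd => ?_
  rw [hF _ _ _ _ _ (hT.attach hd hw) (hT'.attach (h.mem_corners hd) hw')
    (h.attach hT.closed hd hw hw')]
  rfl

theorem IsRelabelling.weightSum_eq {f : Equiv.Perm ℕ} {T T' : Tree} (h : IsRelabelling f T T') :
    T'.weightSum α = T.weightSum α := by
  rw [weightSum, h.corners_eq, Finset.sum_map]
  rfl

theorem IsRelabelling.refl (T : Tree) : IsRelabelling (Equiv.refl ℕ) T T := by
  refine ⟨by ext; simp, fun u _ => ?_⟩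
  have h : (Prod.map (Option.map (Equiv.refl ℕ)) id : Option ℕ × Colour → _) = id := by
    ext x <;> simp
  rw [h, List.map_id]
  exact List.IsRotated.refl _

theorem stepMean_eq {F : Tree → ℝ≥0∞} (hF : IsInvariant F) {χ : Colour} {r : ℕ} {T : Tree}
    (hT : T.IsPlanted χ r) {w : ℕ} (hw : w ∉ T.verts) :
    stepMean α F T = (∑ d ∈ T.corners, ENNReal.ofReal (d.colour.weight α) * F (T.attach d w)) /
      T.weightSum α := by
  rw [stepMean, (IsRelabelling.refl T).sum_attach hF hT hT (sup_add_one_notMem T) hw]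

theorem IsInvariant.stepMean {F : Tree → ℝ≥0∞} (hF : IsInvariant F) :
    IsInvariant (stepMean α F) := by
  rintro χ r r' T T' hT hT' ⟨f, h⟩
  have h : IsRelabelling f T T' := h
  rw [Tree.stepMean, Tree.stepMean, h.weightSum_eq, h.sum_attach hF hT hT'
    (sup_add_one_notMem T) (sup_add_one_notMem T')]

theorem sum_attach_eq {F : Tree → ℝ≥0∞} (hF : IsInvariant F) (hα : 0 < α) {χ : Colour} {r : ℕ}
    {T : Tree} (hT : T.IsPlanted χ r) {w : ℕ} (hw : w ∉ T.verts) :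
    ∑ d ∈ T.corners, ENNReal.ofReal (d.colour.weight α) * F (T.attach d w) =
      stepMean α F T * T.weightSum α := by
  rw [stepMean_eq hF hT hw, ENNReal.div_mul_cancel (hT.weightSum_ne_zero hα)
    (weightSum_ne_top α T)]

theorem stepMean_one (hα : 0 < α) {χ : Colour} {r : ℕ} {T : Tree} (hT : T.IsPlanted χ r) :
    stepMean α (fun _ => 1) T = 1 := by
  simp only [stepMean, mul_one]
  exact ENNReal.div_self (hT.weightSum_ne_zero hα) (weightSum_ne_top α T)

/-- The expectation of `F` for the planted preferential attachment tree with `m` vertices. -/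
noncomputable def plantedMean (α : ℝ) (χ : Colour) (m : ℕ) (F : Tree → ℝ≥0∞) : ℝ≥0∞ :=
  expect (growth α (bud χ) (m - 1)) F

theorem plantedMean_one {χ : Colour} {r : ℕ} {F : Tree → ℝ≥0∞} (hF : IsInvariant F) :
    plantedMean α χ 1 F = F (sprout r χ) := by
  rw [plantedMean, Nat.sub_self, growth, expect_pure]
  exact hF _ _ _ _ _ (sprout_isPlanted 1 χ) (sprout_isPlanted r χ) (sprout_iso 1 r χ)

/-- The Markov property at the last step. For `m = 1` there is no last step: truncated subtraction
would make both sides start from the bud. -/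
theorem plantedMean_stepMean (hα : 0 < α) {χ : Colour} {F : Tree → ℝ≥0∞} (hF : IsInvariant F)
    {m : ℕ} (hm : 2 ≤ m) : plantedMean α χ (m - 1) (stepMean α F) = plantedMean α χ m F := by
  obtain ⟨m, rfl⟩ := Nat.exists_eq_add_of_le' hm
  rw [plantedMean, plantedMean, show m + 2 - 1 - 1 = m by omega, show m + 2 - 1 = m + 1 by omega,
    growth, expect_bind]
  refine expect_congr fun T hT => ?_
  obtain ⟨h1, h2⟩ := growth_bud_support hα χ m T hT
  rw [expect_step (h1.weightSum_ne_zero hα), stepMean_eq hF h1 (card_add_one_notMem h2)]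

end Invariant

/-! ### Factorization given the sizes -/

section Product

variable {S T : Tree} {n k : ℕ}

/-- The product of the `F c (subtree S T c)` on the event that the subtrees have sizes `μ c`. -/
noncomputable def sizedProd (S : Tree) (μ : Corner → ℕ) (F : Corner → Tree → ℝ≥0∞) (T : Tree) :
    ℝ≥0∞ :=
  ∏ c ∈ S.corners, if (subtree S T c).verts.card = μ c then F c (subtree S T c) else 0

theorem sizedProd_eq_zero {μ : Corner → ℕ} {F : Corner → Tree → ℝ≥0∞} {c : Corner}
    (hc : c ∈ S.corners) (h : (subtree S T c).verts.card ≠ μ c) : sizedProd S μ F T = 0 :=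
  Finset.prod_eq_zero hc (if_neg h)

/-- The probability that the corner `c` is drawn when this leads to the sizes `μ`. -/
noncomputable def drawProb (α : ℝ) (S : Tree) (μ : Corner → ℕ) (c : Corner) : ℝ≥0∞ :=
  ENNReal.ofReal (rescaled α c.colour (μ c - 1)) /
    ∑ c' ∈ S.corners, ENNReal.ofReal (rescaled α c'.colour (Function.update μ c (μ c - 1) c'))

/-- The tree at the drawn corner `c` makes one step, which turns its factor into `stepMean`; the
other factors stay. On the prescribed sizes the probability of drawing `c` is a constant, and this
is what yields independence. -/
theorem IsGrown.expect_step_sizedProd (h : IsGrown S n T) (hS : S.IsColouredPlaneTree)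
    (hα : 0 < α) (hne : S.corners.Nonempty) {μ : Corner → ℕ} (hμ : ∀ c ∈ S.corners, 1 ≤ μ c)
    {F : Corner → Tree → ℝ≥0∞} (hF : ∀ c, IsInvariant (F c)) :
    expect (T.step α) (sizedProd S μ F) = ∑ c ∈ S.corners, drawProb α S μ c *
      sizedProd S (Function.update μ c (μ c - 1)) (Function.update F c (stepMean α (F c))) T := by
  rw [h.expect_step hS hα hne]
  refine Finset.sum_congr rfl fun c hc => ?_
  have hw := card_add_one_notMem h.1
  set w := T.verts.card + 1
  have hPw : w ∉ (subtree S T c).verts := fun hh => hw ((h.2.mem_verts w).2 (Or.inr ⟨c, hc, hh⟩))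
  set R : ℝ≥0∞ := ∏ c' ∈ S.corners.erase c,
    if (subtree S T c').verts.card = μ c' then F c' (subtree S T c') else 0 with hR
  have h1 : ∀ d ∈ (subtree S T c).corners, sizedProd S μ F (T.attach (lift c d) w) =
      (if (subtree S T c).verts.card + 1 = μ c then F c ((subtree S T c).attach d w) else 0) *
        R := by
    intro d hd
    rw [sizedProd, ← Finset.mul_prod_erase _ _ hc]
    congr 1
    · rw [h.subtree_attach hS hc hd hc, Function.update_self, attach_verts,
        Finset.card_insert_of_notMem hPw]
    · refine Finset.prod_congr rfl fun c' hc' => ?_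
      rw [Finset.mem_erase] at hc'
      rw [h.subtree_attach hS hc hd hc'.2, Function.update_of_ne hc'.1]
  have h2 : sizedProd S (Function.update μ c (μ c - 1)) (Function.update F c (stepMean α (F c)))
      T = (if (subtree S T c).verts.card = μ c - 1 then stepMean α (F c) (subtree S T c) else 0) *
        R := by
    rw [sizedProd, ← Finset.mul_prod_erase _ _ hc, Function.update_self, Function.update_self]
    congr 1
    refine Finset.prod_congr rfl fun c' hc' => ?_
    rw [Finset.mem_erase] at hc'
    rw [Function.update_of_ne hc'.1, Function.update_of_ne hc'.1]
  rw [h2, Finset.sum_congr rfl fun d hd => by rw [h1 d hd]]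
  -- Both sides vanish unless every size is the prescribed one, that of `c` being one less before
  -- the step.
  by_cases hsize : ∀ c' ∈ S.corners.erase c, (subtree S T c').verts.card = μ c'
  swap
  · push Not at hsize
    obtain ⟨c', hc', hne'⟩ := hsize
    have : R = 0 := Finset.prod_eq_zero hc' (if_neg hne')
    simp [this]
  have hμc := hμ c hc
  by_cases hcard : (subtree S T c).verts.card = μ c - 1
  swap
  · have hcard' : ¬ (subtree S T c).verts.card + 1 = μ c := by omega
    simp only [if_neg hcard, if_neg hcard']
    simp
  have hcard' : (subtree S T c).verts.card + 1 = μ c := by omega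
  simp only [if_pos hcard, if_pos hcard', ← mul_assoc]
  rw [← Finset.sum_mul, sum_attach_eq (hF c) hα (h.2.planted c hc) hPw, drawProb,
    (h.2.planted c hc).weightSum_eq hα, hcard, h.weightSum_eq_rescaled hS hα]
  -- With all sizes known, the total weight no longer depends on `T`.
  have h3 : ∑ c' ∈ S.corners, ENNReal.ofReal (rescaled α c'.colour (subtreeSize S T c')) =
      ∑ c' ∈ S.corners,
        ENNReal.ofReal (rescaled α c'.colour (Function.update μ c (μ c - 1) c')) := by
    refine Finset.sum_congr rfl fun c' hc' => ?_
    by_cases hcc : c' = c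
    · subst hcc
      rw [Function.update_self, subtreeSize, hcard]
    · rw [Function.update_of_ne hcc, subtreeSize, hsize c' (Finset.mem_erase.2 ⟨hcc, hc'⟩)]
  rw [h3]
  simp only [ENNReal.div_eq_inv_mul]
  ring

theorem sizedProd_congr {μ : Corner → ℕ} {F G : Corner → Tree → ℝ≥0∞}
    (h : ∀ c ∈ S.corners, F c (subtree S T c) = G c (subtree S T c)) :
    sizedProd S μ F T = sizedProd S μ G T :=
  Finset.prod_congr rfl fun c hc => by rw [h c hc]

theorem isInvariant_const (a : ℝ≥0∞) : IsInvariant fun _ => a := fun _ _ _ _ _ _ _ _ => rfl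

theorem expect_sizedProd_eq_zero (hS : S.IsSeed k) (hα : 0 < α) (hne : S.corners.Nonempty)
    (m : ℕ) {μ : Corner → ℕ} {c : Corner} (hc : c ∈ S.corners) (hμ : μ c = 0)
    (F : Corner → Tree → ℝ≥0∞) : expect (growth α S m) (sizedProd S μ F) = 0 := by
  rw [← expect_zero (growth α S m)]
  refine expect_congr fun T hT => sizedProd_eq_zero hc ?_
  rw [hμ]
  exact (Finset.card_pos.2 ⟨_, ((growth_support hS hα hne m T hT).2.planted c hc).root_mem⟩).ne'

/-- Given their sizes, the planted subtrees are independent planted preferential attachment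
trees. -/
theorem expect_growth_sizedProd (hS : S.IsSeed k) (hα : 0 < α) (hne : S.corners.Nonempty) (m : ℕ) :
    ∀ (μ : Corner → ℕ) (F : Corner → Tree → ℝ≥0∞), (∀ c, IsInvariant (F c)) →
    expect (growth α S m) (sizedProd S μ F) =
      expect (growth α S m) (sizedProd S μ fun _ _ => 1) *
        ∏ c ∈ S.corners, plantedMean α c.colour (μ c) (F c) := by
  induction m with
  | zero =>
    intro μ F hF
    simp only [growth, expect_pure]
    by_cases h : ∀ c ∈ S.corners, μ c = 1
    · have hsub : ∀ c ∈ S.corners, subtree S S c = sprout c.vertex c.colour :=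
        fun c hc => (Glued.refl hS.tree).subtree_eq hS.tree hc
      have hcard : ∀ c ∈ S.corners, (subtree S S c).verts.card = μ c := by
        intro c hc
        rw [hsub c hc, h c hc]
        rfl
      rw [sizedProd, sizedProd, ← Finset.prod_mul_distrib]
      refine Finset.prod_congr rfl fun c hc => ?_
      rw [if_pos (hcard c hc), if_pos (hcard c hc), h c hc, plantedMean_one (hF c), one_mul,
        hsub c hc]
    · push Not at h
      obtain ⟨c, hc, hμ⟩ := h
      have : (subtree S S c).verts.card ≠ μ c := by
        rw [(Glued.refl hS.tree).subtree_eq hS.tree hc]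
        exact fun hh => hμ hh.symm
      rw [sizedProd_eq_zero hc this, sizedProd_eq_zero hc this, zero_mul]
  | succ m ih =>
    intro μ F hF
    by_cases hμ : ∀ c ∈ S.corners, 1 ≤ μ c
    swap
    · push Not at hμ
      obtain ⟨c, hc, hμ⟩ := hμ
      have hμ : μ c = 0 := by omega
      rw [expect_sizedProd_eq_zero hS hα hne _ hc hμ, expect_sizedProd_eq_zero hS hα hne _ hc hμ,
        zero_mul]
    -- Used for `F` and for the constant function `1`: the two recursions have the same coefficients
    -- and can be compared term by term.
    have key : ∀ G : Corner → Tree → ℝ≥0∞, (∀ c, IsInvariant (G c)) →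
        expect (growth α S (m + 1)) (sizedProd S μ G) = ∑ c ∈ S.corners, drawProb α S μ c *
          expect (growth α S m) (sizedProd S (Function.update μ c (μ c - 1))
            (Function.update G c (stepMean α (G c)))) := by
      intro G hG
      rw [growth, expect_bind]
      rw [expect_congr fun T hT => (growth_support hS hα hne m T hT).expect_step_sizedProd
        hS.tree hα hne hμ hG, expect_finset_sum]
      simp only [expect_const_mul]
    rw [key F hF, key _ fun _ => isInvariant_const 1, Finset.sum_mul]
    refine Finset.sum_congr rfl fun c hc => ?_
    have h1 : expect (growth α S m) (sizedProd S (Function.update μ c (μ c - 1))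
        (Function.update (fun _ _ => 1) c (stepMean α fun _ => 1))) =
        expect (growth α S m) (sizedProd S (Function.update μ c (μ c - 1)) fun _ _ => 1) := by
      refine expect_congr fun T hT => sizedProd_congr fun c' hc' => ?_
      by_cases hcc : c' = c
      · subst hcc
        rw [Function.update_self, stepMean_one hα
          ((growth_support hS hα hne m T hT).2.planted c' hc')]
      · rw [Function.update_of_ne hcc]
    rw [h1, ih, mul_assoc]
    swap
    · intro c'
      by_cases hcc : c' = c
      · subst hcc
        rw [Function.update_self]
        exact (hF c').stepMean
      · rw [Function.update_of_ne hcc]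
        exact hF c'
    congr 1
    have hμc := hμ c hc
    -- Here the lowered size is `0`, for which `plantedMean_stepMean` is not available, but no
    -- subtree is empty and both sides are zero.
    by_cases hμ1 : μ c = 1
    · rw [expect_sizedProd_eq_zero hS hα hne m hc (by simp [hμ1]), zero_mul, zero_mul]
    congr 1
    refine Finset.prod_congr rfl fun c' hc' => ?_
    by_cases hcc : c' = c
    · subst hcc
      rw [Function.update_self, Function.update_self, plantedMean_stepMean hα (hF c') (by omega)]
    · rw [Function.update_of_ne hcc, Function.update_of_ne hcc]

end Product

end Tree

open PlanarPA.Tree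

/-! ### Complements and supports of discrete laws -/

section OuterMeasure

variable {X : Type*}

theorem toOuterMeasure_compl_add (p : PMF X) (A : Set X) :
    p.toOuterMeasure A + p.toOuterMeasure Aᶜ = 1 := by
  classical
  rw [PMF.toOuterMeasure_apply, PMF.toOuterMeasure_apply, ← ENNReal.tsum_add, ← p.tsum_coe]
  exact tsum_congr fun x => Set.indicator_self_add_compl_apply A p x

theorem toOuterMeasure_compl_support (p : PMF X) : p.toOuterMeasure p.supportᶜ = 0 := by
  rw [PMF.toOuterMeasure_apply_eq_zero_iff]
  exact disjoint_compl_right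

theorem toOuterMeasure_singleton (p : PMF X) (x : X) : p.toOuterMeasure {x} = p x :=
  PMF.toOuterMeasure_apply_singleton p x

end OuterMeasure

/-! ### The law of the process, the urn and the conditional law of the subtrees -/

section LawOfProcess

variable {α : ℝ} {k : ℕ} {S : Tree} {Ω : Type*} [MeasurableSpace Ω] {μ : Measure Ω}
  {T : ℕ → Ω → Tree}

/-- Summing over the countable support of `p` gives only a lower bound, as `X` may be uncountable.
The bounds for `A` and its complement add up to the total mass, so both are equalities. -/
theorem measure_eq_of_singleton {ν : Measure Ω} [IsFiniteMeasure ν] {X : Type*} {f : Ω → X}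
    (hf : ∀ A : Set X, MeasurableSet (f ⁻¹' A)) {p : PMF X}
    (h : ∀ y, ν (f ⁻¹' {y}) = ν Set.univ * p y) (A : Set X) :
    ν (f ⁻¹' A) = ν Set.univ * p.toOuterMeasure A := by
  have lower : ∀ B : Set X, ν Set.univ * p.toOuterMeasure B ≤ ν (f ⁻¹' B) := by
    intro B
    have hc : (B ∩ p.support).Countable := p.support_countable.mono Set.inter_subset_right
    calc ν Set.univ * p.toOuterMeasure B
        = ν Set.univ * ∑' y : (B ∩ p.support : Set X), p y := by
          rw [← p.toOuterMeasure_apply_inter_support, PMF.toOuterMeasure_apply,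
            ← tsum_subtype]
      _ = ∑' y : (B ∩ p.support : Set X), ν (f ⁻¹' {(y : X)}) := by
          rw [← ENNReal.tsum_mul_left]
          exact tsum_congr fun y => (h y).symm
      _ = ν (f ⁻¹' (B ∩ p.support)) := tsum_measure_preimage_singleton hc fun y _ => hf {y}
      _ ≤ ν (f ⁻¹' B) := measure_mono (Set.preimage_mono Set.inter_subset_left)
  refine le_antisymm ?_ (lower A)
  by_contra hlt
  rw [not_le] at hlt
  have h1 := ENNReal.add_lt_add_of_lt_of_le (by
    refine ne_top_of_le_ne_top (measure_ne_top ν (f ⁻¹' Aᶜ)) (lower Aᶜ)) hlt (lower Aᶜ)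
  rw [← mul_add, toOuterMeasure_compl_add, mul_one, Set.preimage_compl,
    measure_add_measure_compl (hf A)] at h1
  exact lt_irrefl _ h1

theorem IsPlanarPA.measurableSet_history (hT : IsPlanarPA α k S μ T) (n : ℕ) (t : ℕ → Tree) :
    MeasurableSet {ω | ∀ j ∈ Finset.Icc k n, T j ω = t j} := by
  have : {ω | ∀ j ∈ Finset.Icc k n, T j ω = t j} = ⋂ j ∈ Finset.Icc k n, T j ⁻¹' {t j} := by
    ext ω; simp
  rw [this]
  exact Finset.measurableSet_biInter _ fun j hj =>
    hT.measurable j (Finset.mem_Icc.1 hj).1 _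

variable [IsProbabilityMeasure μ]

theorem IsPlanarPA.transition_set (hT : IsPlanarPA α k S μ T) {n : ℕ} (hn : k ≤ n)
    (t : ℕ → Tree) (A : Set Tree) :
    μ ({ω | ∀ j ∈ Finset.Icc k n, T j ω = t j} ∩ T (n + 1) ⁻¹' A) =
      μ {ω | ∀ j ∈ Finset.Icc k n, T j ω = t j} * ((t n).step α).toOuterMeasure A := by
  have hm := hT.measurable (n + 1) (by omega)
  set E := {ω | ∀ j ∈ Finset.Icc k n, T j ω = t j}
  have key := measure_eq_of_singleton (ν := μ.restrict E) hm (p := (t n).step α) (fun y => by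
    rw [Measure.restrict_apply (hm _), Measure.restrict_apply_univ, Set.inter_comm]
    exact hT.transition n hn t y) A
  rwa [Measure.restrict_apply (hm _), Measure.restrict_apply_univ, Set.inter_comm] at key

theorem IsPlanarPA.exists_countable (hT : IsPlanarPA α k S μ T) (hS : S.IsSeed k) (hα : 0 < α)
    (hne : S.corners.Nonempty) {n : ℕ} (hn : k ≤ n) :
    ∃ H : Set (ℕ → Tree), H.Countable ∧ (∀ t ∈ H, ∀ j ∈ Finset.Icc k n, IsGrown S j (t j)) ∧
      ∀ᵐ ω ∂μ, ∃ t ∈ H, ∀ j ∈ Finset.Icc k n, T j ω = t j := by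
  induction n, hn using Nat.le_induction with
  | base =>
    refine ⟨{fun _ => S}, Set.countable_singleton _, ?_, ?_⟩
    · rintro t rfl j hj
      rw [Finset.Icc_self, Finset.mem_singleton] at hj
      exact hj ▸ isGrown_self hS
    · filter_upwards [hT.start] with ω hω
      refine ⟨_, rfl, fun j hj => ?_⟩
      rw [Finset.Icc_self, Finset.mem_singleton] at hj
      rw [hj, hω]
  | succ n hn ih =>
    obtain ⟨H, hH, hHg, hHae⟩ := ih
    refine ⟨⋃ t ∈ H, (Function.update t (n + 1)) '' ((t n).step α).support,
      hH.biUnion fun t _ => ((t n).step α).support_countable.image _, ?_, ?_⟩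
    · intro t' ht' j hj
      simp only [Set.mem_iUnion, Set.mem_image, exists_prop] at ht'
      obtain ⟨t, ht, y, hy, rfl⟩ := ht'
      rw [Finset.mem_Icc] at hj
      by_cases hjn : j = n + 1
      · subst hjn
        rw [Function.update_self]
        exact (hHg t ht n (Finset.mem_Icc.2 ⟨hn, le_rfl⟩)).of_mem_support_step hS.tree hα hne hy
      · rw [Function.update_of_ne hjn]
        exact hHg t ht j (Finset.mem_Icc.2 ⟨hj.1, by omega⟩)
    · have h1 : ∀ᵐ ω ∂μ, ∀ t ∈ H, (∀ j ∈ Finset.Icc k n, T j ω = t j) →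
          T (n + 1) ω ∈ ((t n).step α).support := by
        rw [ae_ball_iff hH]
        intro t _
        have := hT.transition_set hn t ((t n).step α).supportᶜ
        rw [toOuterMeasure_compl_support, mul_zero] at this
        refine measure_mono_null ?_ this
        intro ω hω
        simp only [Set.mem_compl_iff, Set.mem_ofPred_eq, Classical.not_imp] at hω
        exact hω
      filter_upwards [hHae, h1] with ω hω hω'
      obtain ⟨t, ht, htω⟩ := hω
      refine ⟨Function.update t (n + 1) (T (n + 1) ω), ?_, fun j hj => ?_⟩
      · simp only [Set.mem_iUnion, Set.mem_image, exists_prop]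
        exact ⟨t, ht, _, hω' t ht htω, rfl⟩
      · rw [Finset.mem_Icc] at hj
        by_cases hjn : j = n + 1
        · subst hjn; rw [Function.update_self]
        · rw [Function.update_of_ne hjn]
          exact htω j (Finset.mem_Icc.2 ⟨hj.1, by omega⟩)

/-- If the transition probability to `A` is the same for all grown histories in an event, it can be
taken out of the sum over them. This gives both the law at a fixed time and the Markov property of
the urn, where the tree history is known only through the sizes. -/
theorem IsPlanarPA.transition_event (hT : IsPlanarPA α k S μ T) (hS : S.IsSeed k) (hα : 0 < α)
    (hne : S.corners.Nonempty) {n : ℕ} (hn : k ≤ n) (q : (ℕ → Tree) → Prop)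
    (hq : ∀ t t', (∀ j ∈ Finset.Icc k n, t j = t' j) → q t → q t') (A : Set Tree) (p : ℝ≥0∞)
    (hp : ∀ t, q t → IsGrown S n (t n) → ((t n).step α).toOuterMeasure A = p) :
    μ {ω | q (fun j => T j ω) ∧ T (n + 1) ω ∈ A} = μ {ω | q fun j => T j ω} * p := by
  obtain ⟨H, hH, hHg, hHae⟩ := hT.exists_countable hS hα hne hn
  set f : Ω → (Finset.Icc k n → Tree) := fun ω j => T j ω with hf
  set s : Set (Finset.Icc k n → Tree) := (fun (t : ℕ → Tree) (j : Finset.Icc k n) => t j) ''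
    {t | t ∈ H ∧ q t} with hs
  have hsc : s.Countable := (hH.mono fun t ht => ht.1).image _
  have hfib : ∀ t : ℕ → Tree, f ⁻¹' {fun j : Finset.Icc k n => t j} =
      {ω | ∀ j ∈ Finset.Icc k n, T j ω = t j} := by
    intro t
    ext ω
    simp only [hf, Set.mem_preimage, Set.mem_singleton_iff, funext_iff, Subtype.forall,
      Set.mem_ofPred_eq]
  have hfm : ∀ b ∈ s, MeasurableSet (f ⁻¹' {b}) := by
    rintro b ⟨t, -, rfl⟩
    rw [hfib]
    exact hT.measurableSet_history n t
  -- Almost surely the event is a countable union of histories, so its own measurability is not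
  -- needed.
  have hae : ∀ᵐ ω ∂μ, q (fun j => T j ω) ↔ ω ∈ f ⁻¹' s := by
    filter_upwards [hHae] with ω hω
    obtain ⟨t, ht, htω⟩ := hω
    constructor
    · intro h
      exact ⟨t, ⟨ht, hq _ _ htω h⟩, by funext j; exact (htω j j.2).symm⟩
    · rintro ⟨t', ⟨-, hqt'⟩, h⟩
      refine hq _ _ (fun j hj => ?_) hqt'
      exact congrFun h ⟨j, hj⟩
  have hmA := hT.measurable (n + 1) (by omega) A
  have h1 : μ {ω | q (fun j => T j ω) ∧ T (n + 1) ω ∈ A} =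
      (μ.restrict (T (n + 1) ⁻¹' A)) (f ⁻¹' s) := by
    rw [Measure.restrict_apply' hmA]
    refine measure_congr ?_
    filter_upwards [hae] with ω hω
    exact propext (and_congr_left fun _ => hω)
  have h2 : μ {ω | q fun j => T j ω} = μ (f ⁻¹' s) := by
    refine measure_congr ?_
    filter_upwards [hae] with ω hω
    exact propext hω
  rw [h1, h2, ← tsum_measure_preimage_singleton hsc hfm,
    ← tsum_measure_preimage_singleton hsc hfm, ← ENNReal.tsum_mul_right]
  refine tsum_congr ?_
  rintro ⟨b, t, ⟨htH, htq⟩, rfl⟩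
  rw [Measure.restrict_apply' hmA, hfib, hT.transition_set hn,
    hp t htq (hHg t htH n (Finset.mem_Icc.2 ⟨hn, le_rfl⟩))]

theorem IsPlanarPA.law (hT : IsPlanarPA α k S μ T) (hS : S.IsSeed k) (hα : 0 < α)
    (hne : S.corners.Nonempty) {n : ℕ} (hn : k ≤ n) :
    ∀ A : Set Tree, μ (T n ⁻¹' A) = (growth α S (n - k)).toOuterMeasure A := by
  induction n, hn using Nat.le_induction with
  | base =>
    intro A
    rw [Nat.sub_self, growth]
    have h := measure_eq_of_singleton (ν := μ) (hT.measurable k le_rfl) (p := PMF.pure S) ?_ A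
    · rw [h, measure_univ, one_mul]
    intro y
    rw [measure_univ, one_mul, PMF.pure_apply]
    split_ifs with hy
    · rw [← measure_univ (μ := μ)]
      refine measure_congr ?_
      filter_upwards [hT.start] with ω hω
      exact propext ⟨fun _ => trivial, fun _ => hω.trans hy.symm⟩
    · refine measure_mono_null ?_ hT.start
      intro ω hω hh
      exact hy (hω.symm.trans hh)
  | succ n hn ih =>
    intro A
    set p := growth α S (n - k)
    have hmA := hT.measurable (n + 1) (by omega) A
    have hm := hT.measurable n hn
    have h1 : (growth α S (n + 1 - k)).toOuterMeasure A =
        ∑' t, p t * (t.step α).toOuterMeasure A := by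
      rw [show n + 1 - k = (n - k) + 1 by omega, growth, PMF.toOuterMeasure_bind_apply]
    have h2 : μ (T (n + 1) ⁻¹' A) = (μ.restrict (T (n + 1) ⁻¹' A)) (T n ⁻¹' p.support) := by
      rw [Measure.restrict_apply' hmA]
      refine measure_congr ?_
      have : μ (T n ⁻¹' p.supportᶜ) = 0 := by rw [ih, toOuterMeasure_compl_support]
      have hae : ∀ᵐ ω ∂μ, T n ω ∈ p.support := by
        refine measure_mono_null (fun ω hω => hω) this
      filter_upwards [hae] with ω hω
      exact propext ⟨fun h => ⟨hω, h⟩, fun h => h.2⟩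
    rw [h1, h2, ← tsum_measure_preimage_singleton p.support_countable fun y _ => hm {y}]
    have h3 : ∀ t, (μ.restrict (T (n + 1) ⁻¹' A)) (T n ⁻¹' {t}) =
        p t * (t.step α).toOuterMeasure A := by
      intro t
      rw [Measure.restrict_apply' hmA, ← toOuterMeasure_singleton p t, ← ih]
      refine hT.transition_event hS hα hne hn (fun t' => t' n = t) ?_ A _ ?_
      · intro t₁ t₂ h12 h
        rw [← h12 n (Finset.mem_Icc.2 ⟨hn, le_rfl⟩), h]
      · intro t' ht' _
        rw [ht']
    simp only [h3]
    rw [tsum_subtype p.support fun t => p t * (t.step α).toOuterMeasure A]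
    refine tsum_congr fun t => ?_
    by_cases ht : t ∈ p.support
    · rw [Set.indicator_of_mem ht]
    · rw [Set.indicator_of_notMem ht]
      rw [PMF.mem_support_iff, not_not] at ht
      rw [ht, zero_mul]

/-- The total weight of the corners of `T` lying in `c` is the rescaled size of the subtree at `c`,
and any draw among them adds row `c`. -/
theorem IsGrown.urn_step {n : ℕ} {T : Tree} (h : IsGrown S n T) (hS : S.IsColouredPlaneTree)
    (hα : 0 < α) (hne : S.corners.Nonempty) (x y : S.corners → ℝ)
    (hx : (fun c : S.corners => rescaled α c.1.colour (subtreeSize S T c)) = x) :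
    (T.step α).toOuterMeasure
      {T' | (fun c : S.corners => rescaled α c.1.colour (subtreeSize S T' c)) = y} =
    ∑ c : S.corners, if y = x + ((1 + α) • (1 : Matrix S.corners S.corners ℝ)) c then
      ENNReal.ofReal (x c / ∑ c', x c') else 0 := by
  classical
  have hxpos : ∀ c, 0 < x c := fun c => by
    rw [← hx]; exact (h.2.planted c c.2).rescaled_pos hα
  have hsum : 0 < ∑ c, x c := by
    obtain ⟨c, hc⟩ := hne
    exact Finset.sum_pos (fun c _ => hxpos c) ⟨⟨c, hc⟩, Finset.mem_univ _⟩
  have hW : T.weightSum α = ENNReal.ofReal (∑ c, x c) := by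
    rw [h.weightSum_eq_rescaled hS hα, ENNReal.ofReal_sum_of_nonneg fun c _ => (hxpos c).le,
      ← Finset.sum_coe_sort, ← hx]
  obtain ⟨D, hD⟩ : ∃ D : Set Tree,
    D = {T' | (fun c : S.corners => rescaled α c.1.colour (subtreeSize S T' c)) = y} := ⟨_, rfl⟩
  have hmem : ∀ t, t ∈ D ↔
      (fun c : S.corners => rescaled α c.1.colour (subtreeSize S t c)) = y := by
    intro t; rw [hD]; rfl
  rw [← hD, toOuterMeasure_eq_expect, h.expect_step hS hα hne, ← Finset.sum_coe_sort]
  refine Finset.sum_congr rfl fun c _ => ?_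
  have hw := card_add_one_notMem h.1
  set w := T.verts.card + 1
  have hPw : w ∉ (subtree S T c).verts := fun hh => hw ((h.2.mem_verts w).2 (Or.inr ⟨c, c.2, hh⟩))
  have hnew : ∀ d ∈ (subtree S T c).corners,
      (fun c' : S.corners => rescaled α c'.1.colour (subtreeSize S (T.attach (lift c d) w) c')) =
        x + ((1 + α) • (1 : Matrix S.corners S.corners ℝ)) c := by
    intro d hd
    funext c'
    rw [subtreeSize, h.subtree_attach hS c.2 hd c'.2, ← hx]
    by_cases hcc : c = c'
    · subst hcc
      rw [Function.update_self, attach_verts, Finset.card_insert_of_notMem hPw, rescaled_add_one]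
      simp [subtreeSize]
    · rw [Function.update_of_ne fun hh => hcc (Subtype.ext hh.symm)]
      simp [subtreeSize, hcc]
  have hxc : (subtree S T c).weightSum α = ENNReal.ofReal (x c) := by
    rw [(h.2.planted c c.2).weightSum_eq hα, ← hx]
    rfl
  have hs : ∑ d ∈ (subtree S T c).corners, ENNReal.ofReal (d.colour.weight α) *
      (if T.attach (lift c d) w ∈ D then (1 : ℝ≥0∞) else 0) =
      if y = x + ((1 + α) • (1 : Matrix S.corners S.corners ℝ)) c then
        ENNReal.ofReal (x c) else 0 := by
    rw [← hxc, weightSum]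
    by_cases hy : y = x + ((1 + α) • (1 : Matrix S.corners S.corners ℝ)) c
    · rw [if_pos hy]
      refine Finset.sum_congr rfl fun d hd => ?_
      rw [if_pos, mul_one]
      exact (hmem _).2 ((hnew d hd).trans hy.symm)
    · rw [if_neg hy]
      refine Finset.sum_eq_zero fun d hd => ?_
      rw [if_neg, mul_zero]
      exact fun hh => hy (((hmem _).1 hh).symm.trans (hnew d hd))
  rw [hs, hW, ENNReal.ofReal_div_of_pos hsum]
  split_ifs <;> simp

theorem IsPlanarPA.isPolyaUrn (hT : IsPlanarPA α k S μ T) (hS : S.IsSeed k) (hα : 0 < α)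
    (hne : S.corners.Nonempty) :
    IsPolyaUrn ((1 + α) • (1 : Matrix S.corners S.corners ℝ))
      (fun c => c.1.colour.weight α) k μ
      (fun n ω c => rescaled α c.1.colour (subtreeSize S (T n ω) c)) where
  measurable n hn := by
    refine measurable_pi_iff.2 fun c A _ => ?_
    exact hT.measurable n hn {t | rescaled α c.1.colour (subtreeSize S t c) ∈ A}
  start := by
    filter_upwards [hT.start] with ω hω
    funext c
    rw [hω, subtreeSize, (Glued.refl hS.tree).subtree_eq hS.tree c.2]
    -- With one vertex, `(1 + α) - 1 = α` for red and `(1 + α) - α = 1` for blue.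
    cases hc : c.1.colour <;> simp [sprout, rescaled, Colour.weight]
  transition n hn x y := by
    rw [Finset.sum_filter]
    refine hT.transition_event hS hα hne hn
      (fun t => ∀ j ∈ Finset.Icc k n,
        (fun c : S.corners => rescaled α c.1.colour (subtreeSize S (t j) c)) = x j) ?_
      {T' | (fun c : S.corners => rescaled α c.1.colour (subtreeSize S T' c)) = y} _ ?_
    · intro t t' h hq j hj
      rw [← h j hj]
      exact hq j hj
    · intro t hq ht
      rw [IsGrown.urn_step ht hS.tree hα hne (x n) y (hq n (Finset.mem_Icc.2 ⟨hn, le_rfl⟩))]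

-- The factorization is applied to indicators of sets of shapes, which are invariant under
-- relabelling; the factor common to both probabilities is that of the sizes, and it cancels in the
-- quotient.
open Classical in
theorem IsPlanarPA.cond_subtrees (hT : IsPlanarPA α k S μ T) (hS : S.IsSeed k) (hα : 0 < α)
    (hne : S.corners.Nonempty) {n : ℕ} (hn : k ≤ n) (m : S.corners → ℕ)
    (hm : μ {ω | ∀ c : S.corners, subtreeSize S (T n ω) c = m c} ≠ 0)
    (A : S.corners → Set Shape) :
    μ[{ω | ∀ c : S.corners, (subtree S (T n ω) c).shape ∈ A c} |
        {ω | ∀ c : S.corners, subtreeSize S (T n ω) c = m c}] =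
      ∏ c : S.corners, (plantedLaw α c.1.colour (m c)).toOuterMeasure (A c) := by
  set B : Set Tree := {t | ∀ c : S.corners, subtreeSize S t c = m c} with hB
  set D : Set Tree := {t | ∀ c : S.corners, (subtree S t c).shape ∈ A c} with hD
  set m' : Corner → ℕ := fun c => if h : c ∈ S.corners then m ⟨c, h⟩ else 0 with hm'
  set F : Corner → Tree → ℝ≥0∞ := fun c t =>
    if h : c ∈ S.corners then if t.shape ∈ A ⟨c, h⟩ then 1 else 0 else 0 with hF
  have hFinv : ∀ c, IsInvariant (F c) := by
    intro c χ r r' t t' _ _ h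
    have : t.shape = t'.shape := Quotient.sound h
    simp only [hF, this]
  have hprod : ∀ G : Corner → Tree → ℝ≥0∞, ∀ t, sizedProd S m' G t =
      if t ∈ B then ∏ c ∈ S.corners, G c (subtree S t c) else 0 := by
    intro G t
    by_cases ht : t ∈ B
    · rw [if_pos ht, sizedProd]
      refine Finset.prod_congr rfl fun c hc => ?_
      rw [if_pos]
      simpa [hm', hc, subtreeSize] using ht ⟨c, hc⟩
    · rw [if_neg ht]
      simp only [hB, Set.mem_ofPred_eq, not_forall] at ht
      obtain ⟨c, hc⟩ := ht
      refine sizedProd_eq_zero c.2 ?_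
      simpa [hm', subtreeSize] using hc
  have h1 : μ (T n ⁻¹' B) = expect (growth α S (n - k)) (sizedProd S m' fun _ _ => 1) := by
    rw [hT.law hS hα hne hn, toOuterMeasure_eq_expect]
    refine expect_congr fun t _ => ?_
    rw [hprod, Finset.prod_const_one]
    congr
  have h2 : μ (T n ⁻¹' (B ∩ D)) = expect (growth α S (n - k)) (sizedProd S m' F) := by
    rw [hT.law hS hα hne hn, toOuterMeasure_eq_expect]
    refine expect_congr fun t _ => ?_
    rw [hprod]
    by_cases htB : t ∈ B
    swap
    · rw [if_neg htB, if_neg fun h => htB h.1]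
    rw [if_pos htB]
    by_cases htD : t ∈ D
    · rw [if_pos ⟨htB, htD⟩, Finset.prod_eq_one]
      intro c hc
      simp only [hF, dif_pos hc]
      exact if_pos (htD ⟨c, hc⟩)
    · rw [if_neg fun h => htD h.2]
      simp only [hD, Set.mem_ofPred_eq, not_forall] at htD
      obtain ⟨c, hc⟩ := htD
      refine (Finset.prod_eq_zero c.2 ?_).symm
      simp only [hF, dif_pos c.2]
      exact if_neg hc
  have h3 : ∏ c ∈ S.corners, plantedMean α c.colour (m' c) (F c) =
      ∏ c : S.corners, (plantedLaw α c.1.colour (m c)).toOuterMeasure (A c) := by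
    rw [← Finset.prod_coe_sort]
    refine Finset.prod_congr rfl fun c _ => ?_
    rw [plantedLaw, PMF.toOuterMeasure_map_apply, toOuterMeasure_eq_expect, plantedMean]
    simp only [hm', dif_pos c.2]
    refine expect_congr fun t _ => ?_
    simp only [hF, dif_pos c.2]
    rfl
  have hBm : MeasurableSet (T n ⁻¹' B) := hT.measurable n hn B
  change μ[T n ⁻¹' D | T n ⁻¹' B] = _
  rw [cond_apply hBm, ← Set.preimage_inter, h2, expect_growth_sizedProd hS hα hne _ _ _ hFinv, ← h1,
    h3, ← mul_assoc, ENNReal.inv_mul_cancel (show μ (T n ⁻¹' B) ≠ 0 from hm) (measure_ne_top _ _),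
    one_mul]

end LawOfProcess

/-- Existence of a Markov chain with a given initial state and a given transition kernel. -/
theorem exists_markovChain {X : Type} (x₀ : X) (K : X → PMF X) :
    ∃ (Ω : Type) (_ : MeasurableSpace Ω) (ν : Measure Ω) (Z : ℕ → Ω → X),
      IsProbabilityMeasure ν ∧ (∀ m, ∀ A : Set X, MeasurableSet (Z m ⁻¹' A)) ∧
      (∀ᵐ ω ∂ν, Z 0 ω = x₀) ∧
      ∀ m, ∀ B : ℕ → Set X, ∀ A : Set X,
        ν ({ω | ∀ j ≤ m, Z j ω ∈ B j} ∩ Z (m + 1) ⁻¹' A) =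
          ∫⁻ ω in {ω | ∀ j ≤ m, Z j ω ∈ B j}, (K (Z m ω)).toOuterMeasure A ∂ν := by
  -- With the discrete σ-algebra every family of laws is a kernel.
  let _ : MeasurableSpace X := ⊤
  let κ : (m : ℕ) → Kernel (Π _ : Finset.Iic m, X) X := fun m =>
    { toFun := fun h => (K (h ⟨m, Finset.mem_Iic.2 le_rfl⟩)).toMeasure
      measurable' := (measurable_from_top (f := fun x => (K x).toMeasure)).comp
        (measurable_pi_apply _) }
  have hκ : ∀ m h, κ m h = (K (h ⟨m, Finset.mem_Iic.2 le_rfl⟩)).toMeasure := fun _ _ => rfl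
  have : ∀ m, IsMarkovKernel (κ m) := fun m => ⟨fun h => by rw [hκ]; infer_instance⟩
  -- The Ionescu-Tulcea measure on trajectories; `κ m` looks only at the last state of the history.
  let ν : Measure (ℕ → X) := Kernel.traj (X := fun _ => X) κ 0 fun _ => x₀
  have hX : ∀ A : Set X, MeasurableSet A := fun _ => MeasurableSpace.measurableSet_top
  refine ⟨ℕ → X, inferInstance, ν, fun m ω => ω m, inferInstance, ?_, ?_, ?_⟩
  · intro m A
    exact measurable_pi_apply m (hX A)
  · have hstart : ν.map (Preorder.frestrictLe 0) = Measure.dirac fun _ => x₀ := by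
      rw [Kernel.traj_map_frestrictLe_apply, Kernel.partialTraj_self, Kernel.id_apply]
    have hA : MeasurableSet {h : Π _ : Finset.Iic 0, X | h ⟨0, Finset.mem_Iic.2 le_rfl⟩ ≠ x₀} :=
      measurableSet_preimage (f := fun h : Π _ : Finset.Iic 0, X => h ⟨0, Finset.mem_Iic.2 le_rfl⟩)
        (measurable_pi_apply _) (hX {x₀}ᶜ)
    have h2 := congrArg (fun ρ => ρ {h | h ⟨0, Finset.mem_Iic.2 le_rfl⟩ ≠ x₀}) hstart
    rw [Measure.map_apply (by fun_prop) hA, Measure.dirac_apply' _ hA,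
      Set.indicator_of_notMem] at h2
    · exact h2
    · exact fun hh => hh rfl
  · intro m B A
    have key : ν.map (Preorder.frestrictLe m) ⊗ₘ κ m =
        ν.map fun ω => (Preorder.frestrictLe m ω, ω (m + 1)) := by
      rw [Kernel.traj_map_frestrictLe_apply]
      exact Kernel.partialTraj_compProd_eq_map_traj (X := fun _ => X) (Nat.zero_le m)
    set E : Set (Π _ : Finset.Iic m, X) := {h | ∀ j : Finset.Iic m, h j ∈ B j} with hE
    have hEm : MeasurableSet E := by
      have : E = ⋂ j : Finset.Iic m, (fun h => h j) ⁻¹' B j := by ext h; simp [hE]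
      rw [this]
      exact MeasurableSet.iInter fun j =>
        measurable_pi_apply j (hX (B j))
    have hA := hX A
    have h2 := congrArg (fun ρ => ρ (E ×ˢ A)) key
    rw [Measure.compProd_apply_prod hEm hA, Measure.map_apply (by fun_prop) (hEm.prod hA),
      setLIntegral_map hEm (Kernel.measurable_coe _ hA) (by fun_prop)] at h2
    have hpre : {ω : ℕ → X | ∀ j ≤ m, ω j ∈ B j} = Preorder.frestrictLe m ⁻¹' E := by
      ext ω
      simp [hE, Preorder.frestrictLe]
    rw [hpre]
    refine Eq.trans ?_ (h2.symm.trans ?_)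
    · rfl
    · refine lintegral_congr fun ω => ?_
      rw [hκ, PMF.toMeasure_apply_eq_toOuterMeasure_apply _ hA]
      rfl

theorem pmf_ext_of_expect {X : Type*} {p q : PMF X} (h : ∀ F, expect p F = expect q F) : p = q := by
  classical
  ext x
  obtain ⟨A, hA⟩ : ∃ A : Set X, A = {x} := ⟨_, rfl⟩
  have := h fun y => if y ∈ A then 1 else 0
  rwa [← toOuterMeasure_eq_expect, ← toOuterMeasure_eq_expect, hA, toOuterMeasure_singleton,
    toOuterMeasure_singleton] at this

/-! ### Coupling two seeds -/

section Coupling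

variable {α : ℝ} {S S' : Tree} {n k : ℕ}

/-- The trees `z.1` and `z.2`, grown from `S` and `S'`, have the same planted subtrees at
corresponding corners. -/
structure Coupled (φ : S.corners ≃ S'.corners) (n : ℕ) (z : Tree × Tree) : Prop where
  left : IsGrown S n z.1
  right : IsGrown S' n z.2
  iso : ∀ c : S.corners, (subtree S z.1 c).Iso (subtree S' z.2 (φ c))

/-- The isomorphisms between matched subtrees combine to a map `ψ` from the corners of one tree to
those of the other that carries one draw to the other; attaching at a corner and at its image keeps
the subtrees isomorphic. -/
theorem Coupled.exists_step {φ : S.corners ≃ S'.corners} {z : Tree × Tree} (h : Coupled φ n z)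
    (hS : S.IsColouredPlaneTree) (hS' : S'.IsColouredPlaneTree) (hα : 0 < α)
    (hne : S.corners.Nonempty) :
    ∃ p : PMF (Tree × Tree), p.map Prod.fst = z.1.step α ∧ p.map Prod.snd = z.2.step α ∧
      ∀ z' ∈ p.support, Coupled φ (n + 1) z' := by
  classical
  obtain ⟨T, T'⟩ := z
  obtain ⟨hT, hT', hiso⟩ := h
  simp only at hT hT' hiso
  have hne' : S'.corners.Nonempty := by
    obtain ⟨c, hc⟩ := hne
    exact ⟨_, (φ ⟨c, hc⟩).2⟩
  choose f hf using hiso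
  have hf : ∀ c : S.corners, IsRelabelling (f c) (subtree S T c) (subtree S' T' (φ c)) := hf
  -- Well defined because `lift` is injective; the value off the corners of `T` is arbitrary.
  obtain ⟨ψ, hψ⟩ : ∃ ψ : Corner → Corner, ∀ c : S.corners, ∀ d ∈ (subtree S T c).corners,
      ψ (lift c d) = lift (φ c) (d.relabel (f c)) := by
    refine ⟨fun d => if h : ∃ x : S.corners × Corner, x.2 ∈ (subtree S T x.1).corners ∧
      lift x.1 x.2 = d then lift (φ h.choose.1) (h.choose.2.relabel (f h.choose.1)) else d, ?_⟩
    intro c d hd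
    have h : ∃ x : S.corners × Corner, x.2 ∈ (subtree S T x.1).corners ∧
      lift x.1 x.2 = lift c d := ⟨(c, d), hd, rfl⟩
    simp only [dif_pos h]
    obtain ⟨h1, h2⟩ := hT.2.lift_inj hS h.choose.1.2 c.2 h.choose_spec.1 hd h.choose_spec.2
    rw [h2, Subtype.ext h1]
  have hsum : ∀ F : Corner → ℝ≥0∞,
      ∑ d ∈ T.corners, ENNReal.ofReal (d.colour.weight α) * F (ψ d) =
        ∑ d ∈ T'.corners, ENNReal.ofReal (d.colour.weight α) * F d := by
    intro F
    rw [hT.2.sum_corners hS, hT'.2.sum_corners hS', ← Finset.sum_coe_sort S.corners,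
      ← Finset.sum_coe_sort S'.corners, ← φ.sum_comp]
    refine Finset.sum_congr rfl fun c _ => ?_
    rw [(hf c).corners_eq, Finset.sum_map]
    refine Finset.sum_congr rfl fun d hd => ?_
    rw [hψ c d hd]
    rfl
  have hW : T.weightSum α = T'.weightSum α := by
    have := hsum fun _ => 1
    simp only [mul_one] at this
    exact this
  have h0 := hT.weightSum_ne_zero hS hα hne
  have h0' := hT'.weightSum_ne_zero hS' hα hne'
  have hlaw : (T.cornerLaw α h0).map ψ = T'.cornerLaw α h0' := by
    refine pmf_ext_of_expect fun F => ?_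
    rw [expect_map, expect_cornerLaw, expect_cornerLaw, hsum, hW]
  refine ⟨(T.cornerLaw α h0).map fun d =>
    (T.attach d (T.verts.card + 1), T'.attach (ψ d) (T'.verts.card + 1)), ?_, ?_, ?_⟩
  · rw [PMF.map_comp, step_eq h0]
    rfl
  · rw [PMF.map_comp, step_eq h0', ← hlaw, PMF.map_comp]
    rfl
  · intro z' hz'
    rw [PMF.mem_support_map_iff] at hz'
    obtain ⟨d, hd, rfl⟩ := hz'
    obtain ⟨c, hc, d, hd', rfl⟩ := hT.2.exists_lift_eq (mem_support_cornerLaw h0 hd)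
    have hψd : ψ (lift c d) = _ := hψ ⟨c, hc⟩ d hd'
    rw [hψd]
    have hr := (hf ⟨c, hc⟩).mem_corners hd'
    refine ⟨hT.attach hS hc hd', hT'.attach hS' (φ ⟨c, hc⟩).2 hr, fun c' => ?_⟩
    simp only
    rw [hT.subtree_attach hS hc hd' c'.2, hT'.subtree_attach hS' (φ ⟨c, hc⟩).2 hr (φ c').2]
    by_cases hcc : c' = ⟨c, hc⟩
    · subst hcc
      rw [Function.update_self, Function.update_self]
      refine (hf ⟨c, hc⟩).attach (hT.2.planted c hc).closed hd' (fun hh => ?_) fun hh => ?_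
      · exact card_add_one_notMem hT.1 ((hT.2.mem_verts _).2 (Or.inr ⟨c, hc, hh⟩))
      · exact card_add_one_notMem hT'.1 ((hT'.2.mem_verts _).2 (Or.inr ⟨_, (φ ⟨c, hc⟩).2, hh⟩))
    · rw [Function.update_of_ne fun hh => hcc (Subtype.ext hh),
        Function.update_of_ne fun hh => hcc (φ.injective (Subtype.ext hh))]
      exact ⟨f c', hf c'⟩

theorem coupled_self (hS : S.IsSeed k) (hS' : S'.IsSeed k) {φ : S.corners ≃ S'.corners}
    (hφ : ∀ c, (φ c).1.colour = c.1.colour) : Coupled φ k (S, S') := by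
  refine ⟨isGrown_self hS, isGrown_self hS', fun c => ?_⟩
  simp only
  rw [(Glued.refl hS.tree).subtree_eq hS.tree c.2,
    (Glued.refl hS'.tree).subtree_eq hS'.tree (φ c).2, hφ]
  exact sprout_iso _ _ _

/-- The image of a chain under `g` is again Markov when the image of its transition law depends on
the state only through `g`. This is required only almost surely, since the coupled kernel behaves
well only on coupled pairs. -/
theorem isPlanarPA_of_chain {Ω : Type} [MeasurableSpace Ω] {ν : Measure Ω} {X : Type}
    {Z : ℕ → Ω → X} {x₀ : X} {K : X → PMF X} (hm : ∀ m, ∀ A : Set X, MeasurableSet (Z m ⁻¹' A))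
    (h0 : ∀ᵐ ω ∂ν, Z 0 ω = x₀)
    (htr : ∀ m, ∀ B : ℕ → Set X, ∀ A : Set X,
      ν ({ω | ∀ j ≤ m, Z j ω ∈ B j} ∩ Z (m + 1) ⁻¹' A) =
        ∫⁻ ω in {ω | ∀ j ≤ m, Z j ω ∈ B j}, (K (Z m ω)).toOuterMeasure A ∂ν)
    (g : X → Tree) (hg : g x₀ = S)
    (hK : ∀ m, ∀ᵐ ω ∂ν, (K (Z m ω)).map g = (g (Z m ω)).step α) :
    IsPlanarPA α k S ν fun n ω => g (Z (n - k) ω) where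
  measurable n _ A := hm (n - k) (g ⁻¹' A)
  start := by
    filter_upwards [h0] with ω hω
    rw [Nat.sub_self, hω, hg]
  transition n hn t y := by
    -- The chain starts at time `0` and the trees at time `k`.
    set E := {ω | ∀ j ≤ n - k, Z j ω ∈ g ⁻¹' {t (j + k)}} with hE
    have hEq : {ω | ∀ j ∈ Finset.Icc k n, g (Z (j - k) ω) = t j} = E := by
      ext ω
      constructor
      · intro h j hj
        have := h (j + k) (Finset.mem_Icc.2 ⟨by omega, by omega⟩)
        rwa [Nat.add_sub_cancel] at this
      · intro h j hj
        rw [Finset.mem_Icc] at hj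
        have := h (j - k) (by omega)
        rw [Set.mem_preimage, Nat.sub_add_cancel hj.1] at this
        exact this
    have hEm : MeasurableSet E := by
      have : E = ⋂ j ∈ Finset.Iic (n - k), Z j ⁻¹' (g ⁻¹' {t (j + k)}) := by
        ext ω; simp [hE]
      rw [this]
      exact Finset.measurableSet_biInter _ fun j _ => hm j _
    have h1 : {ω | (∀ j ∈ Finset.Icc k n, g (Z (j - k) ω) = t j) ∧ g (Z (n + 1 - k) ω) = y} =
        E ∩ Z (n - k + 1) ⁻¹' (g ⁻¹' {y}) := by
      rw [← hEq, show n + 1 - k = n - k + 1 by omega]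
      rfl
    rw [h1, hEq, htr, mul_comm, ← setLIntegral_const]
    refine setLIntegral_congr_fun_ae hEm ?_
    filter_upwards [hK (n - k)] with ω hω hωE
    have h2 : g (Z (n - k) ω) = t n := by
      have := hωE (n - k) le_rfl
      rwa [Nat.sub_add_cancel hn] at this
    rw [← PMF.toOuterMeasure_map_apply, hω, toOuterMeasure_singleton, h2]

theorem exists_coupling (hS : S.IsSeed k) (hS' : S'.IsSeed k) (hα : 0 < α)
    (hne : S.corners.Nonempty) (φ : S.corners ≃ S'.corners)
    (hφ : ∀ c, (φ c).1.colour = c.1.colour) :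
    ∃ (Ω' : Type) (_ : MeasurableSpace Ω') (ν : Measure Ω') (R R' : ℕ → Ω' → Tree),
      IsProbabilityMeasure ν ∧ IsPlanarPA α k S ν R ∧ IsPlanarPA α k S' ν R' ∧
      ∀ᵐ ω ∂ν, ∀ n ≥ k, ∀ c : S.corners,
        (subtree S (R n ω) c).shape = (subtree S' (R' n ω) (φ c)).shape := by
  classical
  -- A time-homogeneous kernel suffices because a coupled pair determines `n` as its number of
  -- vertices. Uncoupled pairs, almost surely never reached, get a dummy law.
  have hex : ∀ z : Tree × Tree, ∃ p : PMF (Tree × Tree), ∀ n, Coupled φ n z →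
      p.map Prod.fst = z.1.step α ∧ p.map Prod.snd = z.2.step α ∧
        ∀ z' ∈ p.support, Coupled φ (n + 1) z' := by
    intro z
    by_cases h : ∃ n, Coupled φ n z
    · obtain ⟨n, hn⟩ := h
      obtain ⟨p, hp⟩ := hn.exists_step hS.tree hS'.tree hα hne
      refine ⟨p, fun n' hn' => ?_⟩
      have : n = n' := by
        have h1 := hn.left.1.symm.trans hn'.left.1
        simpa using congrArg Finset.card h1
      exact this ▸ hp
    · exact ⟨PMF.pure z, fun n hn => absurd ⟨n, hn⟩ h⟩
  choose K hK using hex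
  obtain ⟨Ω', mΩ, ν, Z, hν, hm, h0, htr⟩ := exists_markovChain (S, S') K
  have hc : ∀ m, ∀ᵐ ω ∂ν, Coupled φ (k + m) (Z m ω) := by
    intro m
    induction m with
    | zero =>
      filter_upwards [h0] with ω hω
      rw [hω]
      exact coupled_self hS hS' hφ
    | succ m ih =>
      have h1 := htr m (fun _ => Set.univ) {z | Coupled φ (k + m + 1) z}ᶜ
      have h2 : {ω | ∀ j ≤ m, Z j ω ∈ (Set.univ : Set (Tree × Tree))} = Set.univ := by
        ext; simp
      rw [h2, Set.univ_inter, setLIntegral_univ] at h1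
      refine measure_mono_null (fun ω hω => hω) (h1.trans ?_)
      rw [← lintegral_zero (μ := ν)]
      refine lintegral_congr_ae ?_
      filter_upwards [ih] with ω hω
      rw [PMF.toOuterMeasure_apply_eq_zero_iff, Set.disjoint_compl_right_iff_subset]
      exact (hK _ _ hω).2.2
  refine ⟨Ω', mΩ, ν, fun n ω => (Z (n - k) ω).1, fun n ω => (Z (n - k) ω).2, hν, ?_, ?_, ?_⟩
  · refine isPlanarPA_of_chain hm h0 htr Prod.fst rfl fun m => ?_
    filter_upwards [hc m] with ω hω
    exact (hK _ _ hω).1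
  · refine isPlanarPA_of_chain hm h0 htr Prod.snd rfl fun m => ?_
    filter_upwards [hc m] with ω hω
    exact (hK _ _ hω).2.1
  · filter_upwards [ae_all_iff.2 hc] with ω hω n _ c
    exact Quotient.sound ((hω (n - k)).iso c)

end Coupling

end PlanarPA

open PlanarPA in
theorem mainTheorem6 (α : ℝ) (hα : 0 < α) (k : ℕ) (hk : 2 ≤ k) (S : Tree) (hS : S.IsSeed k)
    {Ω : Type*} [MeasurableSpace Ω] (μ : Measure Ω) [IsProbabilityMeasure μ]
    (T : ℕ → Ω → Tree) (hT : IsPlanarPA α k S μ T) :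
    -- the seed has `2k - 2` corners
    S.corners.card = 2 * k - 2 ∧
    -- the rescaled sizes of the planted subtrees form a Pólya urn
    IsPolyaUrn ((1 + α) • (1 : Matrix S.corners S.corners ℝ))
      (fun c => c.1.colour.weight α) k μ
      (fun n ω c => rescaled α c.1.colour (subtreeSize S (T n ω) c)) ∧
    -- given the sizes, the planted subtrees are independent planted preferential attachment trees
    (∀ n ≥ k, ∀ m : S.corners → ℕ,
      μ {ω | ∀ c : S.corners, subtreeSize S (T n ω) c = m c} ≠ 0 →
      ∀ A : S.corners → Set Shape,
        μ[{ω | ∀ c : S.corners, (subtree S (T n ω) c).shape ∈ A c} |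
            {ω | ∀ c : S.corners, subtreeSize S (T n ω) c = m c}] =
          ∏ c : S.corners, (plantedLaw α c.1.colour (m c)).toOuterMeasure (A c)) ∧
    -- two seeds of the same size can be coupled so that the planted subtrees coincide
    (∀ S' : Tree, S'.IsSeed k →
      (∃ φ : S.corners ≃ S'.corners, ∀ c, (φ c).1.colour = c.1.colour) ∧
      ∀ φ : S.corners ≃ S'.corners, (∀ c, (φ c).1.colour = c.1.colour) →
        ∃ (Ω' : Type) (_ : MeasurableSpace Ω') (ν : Measure Ω') (R R' : ℕ → Ω' → Tree),
          IsProbabilityMeasure ν ∧ IsPlanarPA α k S ν R ∧ IsPlanarPA α k S' ν R' ∧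
          ∀ᵐ ω ∂ν, ∀ n ≥ k, ∀ c : S.corners,
            (subtree S (R n ω) c).shape = (subtree S' (R' n ω) (φ c)).shape) := by
  have hcard : ∀ S' : Tree, S'.IsSeed k → S'.verts.card = k := fun S' h => by
    rw [h.verts_eq, Nat.card_Icc, Nat.add_sub_cancel]
  have hcorners := hS.tree.card_corners
  rw [hcard S hS] at hcorners
  -- From `2 ≤ k`, there are `2k - 2 > 0` corners, so the total weight never vanishes and `step`
  -- always attaches a vertex.
  have hne : S.corners.Nonempty := Finset.card_pos.1 (by omega)
  refine ⟨by omega, hT.isPolyaUrn hS hα hne,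
    fun n hn m hm A => hT.cond_subtrees hS hα hne hn m hm A, fun S' hS' => ⟨?_, ?_⟩⟩
  · exact Tree.exists_corner_equiv hS.tree hS'.tree ((hcard S hS).trans (hcard S' hS').symm)
  · exact fun φ hφ => exists_coupling hS hS' hα hne φ hφ
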